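/- Let $\Bbbk$ be an algebraically closed field of characteristic zero, $G$ a finite abelian group, $\widehat G=\mathrm{Hom}(G,\Bbbk^\times)$, and $\theta\ge 0$ an integer. Let $g_1,\dots,g_\theta\in G$ and $\chi_1,\dots,\chi_\theta\in\widehat G$ be such that $m_i:=\mathrm{ord}(\chi_i(g_i))\ge 2$ for all $i$ and $\chi_j(g_i)\chi_i(g_j)=1$ for all $i\ne j$. Let $B$ be the associated bosonization of a quantum linear space, that is, the Hopf algebra over $\Bbbk$ generated by the elements of $G$ and by $x_1,\dots,x_\theta$, subject to the relations of $G$ and \[ gx_i=\chi_i(g)\,x_ig,\qquad x_i^{m_i}=0,\qquad x_ix_j=\chi_j(g_i)\,x_jx_i\quad(g\in G,\ i\neq j),\] with $\Delta(g)=g\otimes g$ for $g \in G$ and $\Delta(x_i)=g_i\otimes x_i+x_i\otimes 1$. For $\chi\in\widehat G$ put \[ e_\chi=\frac1{|G|}\sum_{g\in G}\chi(g)g,\qquad t_\chi=e_\chi\,x_1^{m_1-1}\cdots x_\theta^{m_\theta-1}\in B. \] Let $R$ be a left $B$-module algebra that is a domain (not necessarily commutative), and write $h(r)$ for the action of $h\in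 B$ on $r\in R$. Let $R\#B$ be the smash product: the vector space $R\otimes B$ with multiplication $(r\#h)(r'\#h')=\sum r\,h_{1}(r')\#h_{2}h'$, where $\Delta(h)=\sum h_1\otimes h_2$. Put $R^x=\{r\in R: x_i(r)=0 \text{ for all } i\}$. The following are equivalent. 1. $R\#B$ is a prime ring. 2. $t_\chi(R)\neq 0$ for all $\chi\in\widehat G$. 3. There is a permutation $\sigma$ of $\{1,\dots,\theta\}$ such that for every $k\in\{0,\dots,\theta-1\}$ we have $x_{\sigma(k+1)}(R_k)\neq 0$, where $R_k=\{r\in R: x_{\sigma(i)}(r)=0\text{ for } 1\le i\le k\}$ (so $R_0=R$); and for each $\chi\in\widehat G$ there is a nonzero $a\in R^x$ such that $g(a)=\chi(g^{-1})a$ for all $g\in G$. -/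

import Mathlib

open scoped TensorProduct

/-! ### Prime rings -/

/-- A (not necessarily commutative) ring is prime if it is nonzero and `I * J = 0` implies
`I = 0` or `J = 0` for all two-sided ideals `I`, `J`. -/
def IsPrimeRing (A : Type*) [Ring A] : Prop :=
  Nontrivial A ∧ ∀ I J : TwoSidedIdeal A,
    (∀ a ∈ I, ∀ b ∈ J, a * b = 0) → I = ⊥ ∨ J = ⊥

/-! ### Module algebras and smash products -/

/-- `R` is a left `H`-module algebra: it is a left `H`-module (compatibly with the `k`-structures),
`h • 1 = ε(h) 1`, and `h • (r s) = ∑ (h₁ • r) (h₂ • s)` where `Δ h = ∑ h₁ ⊗ h₂`. -/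
class IsModuleAlgebra (k H R : Type*) [CommRing k] [Ring H] [Bialgebra k H] [Ring R]
    [Algebra k R] [Module H R] [IsScalarTower k H R] : Prop where
  smul_one : ∀ h : H, h • (1 : R) = Coalgebra.counit (R := k) h • (1 : R)
  smul_mul : ∀ (h : H) (r s : R), h • (r * s) =
    LinearMap.mul' k R (TensorProduct.map
      ((Algebra.lsmul k k R : H →ₐ[k] Module.End k R).toLinearMap.flip r)
      ((Algebra.lsmul k k R : H →ₐ[k] Module.End k R).toLinearMap.flip s)
      (Coalgebra.comul (R := k) h))

/-- The underlying `k`-module `R ⊗ H` of the smash product algebra `R # H`. -/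
def SmashProduct (k R H : Type*) [CommRing k] [Ring H] [Algebra k H] [Ring R] [Algebra k R] :
    Type _ := R ⊗[k] H

namespace SmashProduct

section
variable (k R H : Type*) [CommRing k] [Ring H] [Bialgebra k H] [Ring R] [Algebra k R]

noncomputable instance : AddCommGroup (SmashProduct k R H) :=
  inferInstanceAs (AddCommGroup (R ⊗[k] H))

noncomputable instance : Module k (SmashProduct k R H) :=
  inferInstanceAs (Module k (R ⊗[k] H))

/-- Left multiplication by an element of `R` on the first factor of `R ⊗ H`. -/
noncomputable def actR : R →ₐ[k] Module.End k (R ⊗[k] H) :=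
  (Module.endTensorEndAlgHom (R := k) (S := k) (A := k) (M := R) (N := H)).comp
    (Algebra.TensorProduct.includeLeft.comp (Algebra.lmul k R))

theorem actR_tmul {k R H : Type*} [CommRing k] [Ring H] [Bialgebra k H] [Ring R]
    [Algebra k R] (r s : R) (h : H) : actR k R H r (s ⊗ₜ[k] h) =
      (r * s) ⊗ₜ[k] h := by
  simp [actR, Module.endTensorEndAlgHom]

variable [Module H R] [IsScalarTower k H R]

/-- The diagonal action of `H` on `R ⊗ H`: `h (r ⊗ h') = ∑ (h₁ • r) ⊗ h₂ h'`. -/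
noncomputable def actH : H →ₐ[k] Module.End k (R ⊗[k] H) :=
  (Module.endTensorEndAlgHom (R := k) (S := k) (A := k) (M := R) (N := H)).comp
    ((Algebra.TensorProduct.map (Algebra.lsmul k k R) (Algebra.lmul k H)).comp
      (Bialgebra.comulAlgHom k H))

/-- The multiplication of the smash product, as the linear map sending `r ⊗ h` to the operator
`r' ⊗ h' ↦ ∑ r (h₁ • r') ⊗ h₂ h'`. -/
noncomputable def mulMap : R ⊗[k] H →ₗ[k] Module.End k (R ⊗[k] H) :=
  TensorProduct.lift ((LinearMap.mul k (Module.End k (R ⊗[k] H))).compl₁₂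
    (actR k R H).toLinearMap (actH k R H).toLinearMap)

noncomputable instance : Mul (SmashProduct k R H) :=
  ⟨fun a b => (mulMap k R H a b : R ⊗[k] H)⟩

noncomputable instance : One (SmashProduct k R H) := ⟨(1 : R ⊗[k] H)⟩

/-- The element `r # h` of `R # H`. -/
noncomputable def tmul {k R H : Type*} [CommRing k] [Ring H] [Bialgebra k H] [Ring R]
    [Algebra k R] (r : R) (h : H) : SmashProduct k R H := (r ⊗ₜ[k] h : R ⊗[k] H)

variable {k R H}

theorem mulMap_tmul (r : R) (h : H) : mulMap k R H (r ⊗ₜ[k] h) = actR k R H r * actH k R H h := by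
  simp [mulMap]

theorem actH_of_comul {ι : Type*} (s : Finset ι) (r' : R) (h h' : H) (h₁ h₂ : ι → H)
    (hh : Coalgebra.comul (R := k) h = ∑ i ∈ s, h₁ i ⊗ₜ[k] h₂ i) :
    actH k R H h (r' ⊗ₜ[k] h') = ∑ i ∈ s, (h₁ i • r') ⊗ₜ[k] (h₂ i * h') := by
  simp [actH, hh, LinearMap.sum_apply, Module.endTensorEndAlgHom]

/-- `(r # h) (r' # h') = ∑ r (h₁ • r') # h₂ h'`. -/
theorem tmul_mul_tmul {ι : Type*} (s : Finset ι) (r r' : R) (h h' : H) (h₁ h₂ : ι → H)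
    (hh : Coalgebra.comul (R := k) h = ∑ i ∈ s, h₁ i ⊗ₜ[k] h₂ i) :
    (tmul r h * tmul r' h' : SmashProduct k R H) =
      ∑ i ∈ s, tmul (r * (h₁ i • r')) (h₂ i * h') := by
  change mulMap k R H (r ⊗ₜ[k] h) (r' ⊗ₜ[k] h') =
    (∑ i ∈ s, (r * (h₁ i • r')) ⊗ₜ[k] (h₂ i * h') : R ⊗[k] H)
  rw [mulMap_tmul, Module.End.mul_apply]
  rw [actH_of_comul s r' h h' h₁ h₂ hh, map_sum]
  simp [actR_tmul]

theorem one_mulMap : mulMap k R H (1 : R ⊗[k] H) = 1 := by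
  rw [Algebra.TensorProduct.one_def, mulMap_tmul, map_one, map_one, one_mul]

variable [IsModuleAlgebra k H R]

theorem actH_mul_actR (h : H) (r : R) : actH k R H h * actR k R H r =
    mulMap k R H (actH k R H h (r ⊗ₜ[k] (1 : H))) := by
  refine TensorProduct.ext' fun s h' => ?_
  let act : H →ₗ[k] Module.End k R := (Algebra.lsmul k k R : H →ₐ[k] Module.End k R).toLinearMap
  let μ : H ⊗[k] H →ₗ[k] R := LinearMap.mul' k R ∘ₗ TensorProduct.map (act.flip r) (act.flip s)
  let Ψ : (H ⊗[k] H) ⊗[k] H →ₗ[k] R ⊗[k] H := TensorProduct.map μ (LinearMap.mulRight k h')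
  have hΨ : ∀ a b c : H, Ψ ((a ⊗ₜ b) ⊗ₜ c) = ((a • r) * (b • s)) ⊗ₜ (c * h') := fun a b c => rfl
  have h1 : ∀ a c : H, Ψ (Coalgebra.comul (R := k) a ⊗ₜ c) = (a • (r * s)) ⊗ₜ (c * h') := by
    intro a c
    rw [IsModuleAlgebra.smul_mul (k := k)]
    rfl
  obtain ⟨S, hS⟩ := TensorProduct.exists_finset (R := k) (Coalgebra.comul (R := k) h)
  have h3 : ∀ a b : H, mulMap k R H ((a • r) ⊗ₜ[k] b) (s ⊗ₜ h') =
      Ψ ((TensorProduct.assoc k H H H).symm (a ⊗ₜ Coalgebra.comul (R := k) b)) := by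
    intro a b
    obtain ⟨T, hT⟩ := TensorProduct.exists_finset (R := k) (Coalgebra.comul (R := k) b)
    rw [mulMap_tmul, Module.End.mul_apply, actH_of_comul T s b h' Prod.fst Prod.snd hT, hT,
      map_sum, TensorProduct.tmul_sum, map_sum, map_sum]
    refine Finset.sum_congr rfl fun i _ => ?_
    rw [actR_tmul, TensorProduct.assoc_symm_tmul, hΨ]
  have hco := congrArg (TensorProduct.assoc k H H H).symm (Coalgebra.coassoc_apply (R := k) h)
  rw [LinearEquiv.symm_apply_apply] at hco
  have hco2 := congrArg Ψ hco
  rw [Module.End.mul_apply, actR_tmul, actH_of_comul S (r * s) h h' Prod.fst Prod.snd hS,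
    actH_of_comul S r h 1 Prod.fst Prod.snd hS, map_sum, LinearMap.sum_apply]
  simp only [mul_one, h3]
  rw [hS] at hco2
  simpa [h1, map_sum] using hco2

theorem mulMap_mulMap (a b : R ⊗[k] H) :
    mulMap k R H (mulMap k R H a b) = mulMap k R H a * mulMap k R H b := by
  have hR : ∀ (r : R) (z : R ⊗[k] H),
      mulMap k R H (actR k R H r z) = actR k R H r * mulMap k R H z := by
    intro r z
    induction z with
    | zero => simp
    | add x y hx hy => rw [map_add, map_add, hx, hy, map_add, mul_add]
    | tmul s h => rw [actR_tmul, mulMap_tmul, mulMap_tmul, map_mul, mul_assoc]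
  have hH : ∀ (h h' : H) (r : R), mulMap k R H (actH k R H h (r ⊗ₜ[k] h')) =
      mulMap k R H (actH k R H h (r ⊗ₜ[k] (1 : H))) * actH k R H h' := by
    intro h h' r
    obtain ⟨S, hS⟩ := TensorProduct.exists_finset (R := k) (Coalgebra.comul (R := k) h)
    rw [actH_of_comul S r h h' Prod.fst Prod.snd hS, actH_of_comul S r h 1 Prod.fst Prod.snd hS,
      map_sum, map_sum, Finset.sum_mul]
    refine Finset.sum_congr rfl fun i _ => ?_
    rw [mulMap_tmul, mulMap_tmul, mul_one, map_mul, mul_assoc]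
  induction a with
  | zero => simp
  | add x y hx hy => rw [map_add, LinearMap.add_apply, map_add, hx, hy, add_mul]
  | tmul r h =>
    induction b with
    | zero => simp
    | add x y hx hy => rw [map_add, map_add, hx, hy, map_add, mul_add]
    | tmul r' h' =>
      rw [mulMap_tmul, mulMap_tmul, Module.End.mul_apply, hR, hH, ← actH_mul_actR, mul_assoc,
        mul_assoc]

theorem mulMap_one (z : R ⊗[k] H) : mulMap k R H z (1 : R ⊗[k] H) = z := by
  rw [Algebra.TensorProduct.one_def]
  induction z with
  | zero => simp
  | add x y hx hy => rw [map_add, LinearMap.add_apply, hx, hy]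
  | tmul r h =>
    obtain ⟨S, hS⟩ := TensorProduct.exists_finset (R := k) (Coalgebra.comul (R := k) h)
    have hc := Coalgebra.rTensor_counit_comul (R := k) h
    rw [mulMap_tmul, Module.End.mul_apply, actH_of_comul S 1 h 1 Prod.fst Prod.snd hS]
    rw [hS, map_sum] at hc
    have hc' := congrArg (TensorProduct.lid k H) hc
    simp only [map_sum, LinearMap.rTensor_tmul, TensorProduct.lid_tmul, one_smul] at hc'
    simp only [map_sum, actR_tmul, IsModuleAlgebra.smul_one (k := k), mul_one,
      TensorProduct.smul_tmul]
    rw [← TensorProduct.tmul_sum, hc']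

noncomputable instance : Ring (SmashProduct k R H) :=
  { (inferInstance : AddCommGroup (SmashProduct k R H)) with
    mul := (· * ·)
    one := 1
    left_distrib := fun a b c => map_add (mulMap k R H a) b c
    right_distrib := fun a b c => LinearMap.congr_fun (map_add (mulMap k R H) a b) c
    zero_mul := fun a => LinearMap.congr_fun (map_zero (mulMap k R H)) a
    mul_zero := fun a => map_zero (mulMap k R H a)
    mul_assoc := fun a b c => LinearMap.congr_fun (mulMap_mulMap (k := k) (R := R) (H := H) a b) c
    one_mul := fun a => LinearMap.congr_fun (one_mulMap (k := k) (R := R) (H := H)) a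
    mul_one := fun a => mulMap_one (k := k) (R := R) (H := H) a }

noncomputable instance : Algebra k (SmashProduct k R H) :=
  Algebra.ofModule
    (fun c a b => LinearMap.congr_fun (map_smul (mulMap k R H) c a) b)
    (fun c a b => map_smul (mulMap k R H a) c b)

end

end SmashProduct

/-! ### Powers of a sum of two `q`-commuting elements -/

/-- Gaussian binomial coefficients, defined by a Pascal recursion. -/
def gaussCoeff {k : Type*} [Field k] (q : k) : ℕ → ℕ → k
  | _, 0 => 1
  | 0, _ + 1 => 0
  | n + 1, j + 1 => gaussCoeff q n j + q ^ (j + 1) * gaussCoeff q n (j + 1)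

theorem gaussCoeff_zero {k : Type*} [Field k] (q : k) (n : ℕ) : gaussCoeff q n 0 = 1 := by
  cases n <;> rfl

theorem gaussCoeff_of_lt {k : Type*} [Field k] (q : k) :
    ∀ n j : ℕ, n < j → gaussCoeff q n j = 0 := by
  intro n
  induction n with
  | zero => intro j hj; obtain ⟨j, rfl⟩ := Nat.exists_eq_succ_of_ne_zero (by omega : j ≠ 0); rfl
  | succ n ih =>
    intro j hj
    obtain ⟨j, rfl⟩ := Nat.exists_eq_succ_of_ne_zero (by omega : j ≠ 0)
    change gaussCoeff q n j + q ^ (j + 1) * gaussCoeff q n (j + 1) = 0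
    rw [ih j (by omega), ih (j + 1) (by omega)]; ring

theorem gaussCoeff_self {k : Type*} [Field k] (q : k) (n : ℕ) : gaussCoeff q n n = 1 := by
  induction n with
  | zero => rfl
  | succ n ih =>
    change gaussCoeff q n n + q ^ (n + 1) * gaussCoeff q n (n + 1) = 1
    rw [ih, gaussCoeff_of_lt q n (n + 1) (by omega)]; ring

theorem gaussCoeff_rel {k : Type*} [Field k] (q : k) : ∀ n j d : ℕ, n = j + d →
    (q ^ (j + 1) - 1) * gaussCoeff q n (j + 1) = (q ^ d - 1) * gaussCoeff q n j := by
  intro n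
  induction n with
  | zero =>
    intro j d h
    obtain rfl : d = 0 := by omega
    rw [gaussCoeff_of_lt q 0 (j + 1) (by omega)]; simp
  | succ n ih =>
    have key : ∀ j d : ℕ, n = j + d →
        (q ^ (j + 1) - 1) * gaussCoeff q (n + 1) (j + 1) =
          (q ^ (n + 1) - 1) * gaussCoeff q n j := by
      intro j d h
      have := ih j d h
      change (q ^ (j + 1) - 1) * (gaussCoeff q n j + q ^ (j + 1) * gaussCoeff q n (j + 1)) = _
      subst h
      linear_combination q ^ (j + 1) * this
    intro j d h
    rcases d with _ | d
    · obtain rfl : j = n + 1 := by omega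
      rw [gaussCoeff_of_lt q (n + 1) (n + 1 + 1) (by omega)]; simp
    · rw [key j d (by omega)]
      rcases j with _ | j
      · rw [gaussCoeff_zero, gaussCoeff_zero]
        obtain rfl : d = n := by omega
        rfl
      · have := ih j (d + 1) (by omega)
        change _ = (q ^ (d + 1) - 1) *
          (gaussCoeff q n j + q ^ (j + 1) * gaussCoeff q n (j + 1))
        obtain rfl : n = j + 1 + d := by omega
        linear_combination this

theorem gaussCoeff_eq_zero {k : Type*} [Field k] {q : k} {m : ℕ} (hq : IsPrimitiveRoot q m)
    {j : ℕ} (h0 : 0 < j) (hj : j < m) : gaussCoeff q m j = 0 := by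
  induction j with
  | zero => omega
  | succ j ih =>
    have h := gaussCoeff_rel q m j (m - j) (by omega)
    have hne : q ^ (j + 1) - 1 ≠ 0 := sub_ne_zero.2 (hq.pow_ne_one_of_pos_of_lt (by omega) hj)
    have hz : (q ^ (m - j) - 1) * gaussCoeff q m j = 0 := by
      rcases Nat.eq_zero_or_pos j with rfl | hpos
      · rw [Nat.sub_zero, hq.pow_eq_one]; simp
      · rw [ih hpos (by omega), mul_zero]
    rw [hz] at h
    exact (mul_eq_zero.1 h).resolve_left hne

theorem add_pow_gauss {k A : Type*} [Field k] [Ring A] [Algebra k A] (q : k) (a b : A)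
    (hab : b * a = q • (a * b)) (n : ℕ) :
    (a + b) ^ n = ∑ j ∈ Finset.range (n + 1), gaussCoeff q n j • (a ^ j * b ^ (n - j)) := by
  have hba : ∀ j : ℕ, b * a ^ j = q ^ j • (a ^ j * b) := by
    intro j
    induction j with
    | zero => simp
    | succ j ih =>
      rw [pow_succ, ← mul_assoc, ih, smul_mul_assoc, mul_assoc, hab, mul_smul_comm, smul_smul,
        ← pow_succ, mul_assoc]
  induction n with
  | zero => simp [gaussCoeff_zero]
  | succ n ih =>
    have e1 : ∀ j ∈ Finset.range (n + 1), b * (gaussCoeff q n j • (a ^ j * b ^ (n - j))) =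
        (q ^ j * gaussCoeff q n j) • (a ^ j * b ^ (n + 1 - j)) := by
      intro j hj
      have : n + 1 - j = (n - j) + 1 := by have := Finset.mem_range.1 hj; omega
      rw [mul_smul_comm, ← mul_assoc, hba, smul_mul_assoc, smul_smul, mul_comm, mul_assoc,
        ← pow_succ', this]
    have e2 : ∀ j ∈ Finset.range (n + 1), a * (gaussCoeff q n j • (a ^ j * b ^ (n - j))) =
        gaussCoeff q n j • (a ^ (j + 1) * b ^ (n + 1 - (j + 1))) := by
      intro j _
      rw [mul_smul_comm, ← mul_assoc, ← pow_succ', Nat.add_sub_add_right]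
    rw [pow_succ', ih, add_mul, Finset.mul_sum, Finset.mul_sum, Finset.sum_congr rfl e1,
      Finset.sum_congr rfl e2, Finset.sum_range_succ' _ (n + 1)]
    have e3 : ∑ j ∈ Finset.range (n + 1), (q ^ j * gaussCoeff q n j) • (a ^ j * b ^ (n + 1 - j)) =
        ∑ j ∈ Finset.range (n + 1), (q ^ (j + 1) * gaussCoeff q n (j + 1)) •
          (a ^ (j + 1) * b ^ (n + 1 - (j + 1))) + b ^ (n + 1) := by
      have := Finset.sum_range_succ' (fun j => (q ^ j * gaussCoeff q n j) •
        (a ^ j * b ^ (n + 1 - j))) (n + 1)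
      rw [Finset.sum_range_succ, gaussCoeff_of_lt q n (n + 1) (by omega)] at this
      simpa [gaussCoeff_zero] using this
    rw [e3, ← add_assoc, ← Finset.sum_add_distrib]
    simp only [gaussCoeff_zero, pow_zero, one_mul, one_smul, Nat.sub_zero, ← add_smul]
    rfl

theorem add_pow_of_isPrimitiveRoot {k A : Type*} [Field k] [Ring A] [Algebra k A] {q : k} {m : ℕ}
    (hq : IsPrimitiveRoot q m) (hm : 0 < m) (a b : A) (hab : b * a = q • (a * b)) :
    (a + b) ^ m = a ^ m + b ^ m := by
  rw [add_pow_gauss q a b hab, Finset.sum_range_succ, gaussCoeff_self]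
  obtain ⟨m, rfl⟩ := Nat.exists_eq_succ_of_ne_zero hm.ne'
  rw [Finset.sum_range_succ', Finset.sum_eq_zero]
  · simp [gaussCoeff_zero, add_comm]
  · intro j hj
    rw [gaussCoeff_eq_zero hq (by omega) (by have := Finset.mem_range.1 hj; omega), zero_smul]

/-! ### Bosonizations of quantum linear spaces -/

/-- The data defining a (bosonization of a) quantum linear space of rank `θ` over the abelian group
`G`: elements `g i` of `G` and characters `χ i` of `G` such that `m i := ord (χ i (g i)) ≥ 2`, and
`χ j (g i) * χ i (g j) = 1` for `i ≠ j`. -/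
structure QLSDatum (k G : Type*) [Field k] [CommGroup G] (θ : ℕ) where
  g : Fin θ → G
  χ : Fin θ → (G →* kˣ)
  two_le_orderOf : ∀ i, 2 ≤ orderOf (χ i (g i))
  χ_mul_χ : ∀ i j, i ≠ j → χ j (g i) * χ i (g j) = 1

namespace QLSDatum

section
variable {k G : Type*} [Field k] [CommGroup G] {θ : ℕ} (D : QLSDatum k G θ)

/-- The order `m i` of `χ i (g i)`. -/
noncomputable def m (i : Fin θ) : ℕ := orderOf (D.χ i (D.g i))

/-- The defining relations, on the free algebra with generators `G` and `x i`. -/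
inductive Rel : FreeAlgebra k (G ⊕ Fin θ) → FreeAlgebra k (G ⊕ Fin θ) → Prop
  | one : Rel (FreeAlgebra.ι k (Sum.inl 1)) 1
  | mul (a b : G) : Rel (FreeAlgebra.ι k (Sum.inl (a * b)))
      (FreeAlgebra.ι k (Sum.inl a) * FreeAlgebra.ι k (Sum.inl b))
  | comm (a : G) (i : Fin θ) :
      Rel (FreeAlgebra.ι k (Sum.inl a) * FreeAlgebra.ι k (Sum.inr i))
        ((D.χ i a : k) • (FreeAlgebra.ι k (Sum.inr i) * FreeAlgebra.ι k (Sum.inl a)))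
  | pow (i : Fin θ) : Rel (FreeAlgebra.ι k (Sum.inr i) ^ D.m i) 0
  | skew (i j : Fin θ) (hij : i ≠ j) :
      Rel (FreeAlgebra.ι k (Sum.inr i) * FreeAlgebra.ι k (Sum.inr j))
        ((D.χ j (D.g i) : k) • (FreeAlgebra.ι k (Sum.inr j) * FreeAlgebra.ι k (Sum.inr i)))

end

end QLSDatum

/-- The algebra `B(G, g, χ)` generated by the elements of `G` and `x i`, `i : Fin θ`, with the
relations of `G` and `a x_i = χ_i(a) x_i a`, `x_i ^ m_i = 0`, `x_i x_j = χ_j(g_i) x_j x_i`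
for `i ≠ j`. -/
def Bosonization {k G : Type*} [Field k] [CommGroup G] {θ : ℕ} (D : QLSDatum k G θ) : Type _ :=
  RingQuot D.Rel

namespace Bosonization

section
variable {k G : Type*} [Field k] [CommGroup G] {θ : ℕ} (D : QLSDatum k G θ)

noncomputable instance : Ring (Bosonization D) := inferInstanceAs (Ring (RingQuot D.Rel))

noncomputable instance : Algebra k (Bosonization D) :=
  inferInstanceAs (Algebra k (RingQuot D.Rel))

/-- The quotient map from the free algebra. -/
noncomputable def mk : FreeAlgebra k (G ⊕ Fin θ) →ₐ[k] Bosonization D :=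
  RingQuot.mkAlgHom k D.Rel

/-- The image in `B(G, g, χ)` of a group element. -/
noncomputable def of (a : G) : Bosonization D := mk D (FreeAlgebra.ι k (Sum.inl a))

/-- The generator `x i` of `B(G, g, χ)`. -/
noncomputable def x (i : Fin θ) : Bosonization D := mk D (FreeAlgebra.ι k (Sum.inr i))

theorem mk_rel {u v : FreeAlgebra k (G ⊕ Fin θ)} (h : D.Rel u v) : mk D u = mk D v :=
  RingQuot.mkAlgHom_rel k h

theorem of_one : of D 1 = 1 := by simpa [of] using mk_rel D .one

theorem of_mul (a b : G) : of D (a * b) = of D a * of D b := by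
  simpa [of] using mk_rel D (.mul a b)

theorem of_mul_x (a : G) (i : Fin θ) : of D a * x D i = (D.χ i a : k) • (x D i * of D a) := by
  simpa [of, x] using mk_rel D (.comm a i)

theorem x_pow (i : Fin θ) : x D i ^ D.m i = 0 := by
  simpa [x] using mk_rel D (.pow i)

theorem x_mul_x {i j : Fin θ} (hij : i ≠ j) :
    x D i * x D j = (D.χ j (D.g i) : k) • (x D j * x D i) := by
  simpa [x] using mk_rel D (.skew i j hij)

theorem of_mul_of_inv (a : G) : of D a * of D a⁻¹ = 1 := by
  rw [← of_mul, mul_inv_cancel, of_one]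

theorem of_inv_mul_of (a : G) : of D a⁻¹ * of D a = 1 := by
  rw [← of_mul, inv_mul_cancel, of_one]

variable {D}

/-- The universal property of the presentation. -/
noncomputable def lift {A : Type*} [Ring A] [Algebra k A] (f : G → A) (y : Fin θ → A)
    (h1 : f 1 = 1) (hmul : ∀ a b, f (a * b) = f a * f b)
    (hcomm : ∀ a i, f a * y i = (D.χ i a : k) • (y i * f a))
    (hpow : ∀ i, y i ^ D.m i = 0)
    (hskew : ∀ i j, i ≠ j → y i * y j = (D.χ j (D.g i) : k) • (y j * y i)) :
    Bosonization D →ₐ[k] A :=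
  RingQuot.liftAlgHom k ⟨FreeAlgebra.lift k (Sum.elim f y), by
    intro u v h
    cases h with
    | one => simpa using h1
    | mul a b => simpa using hmul a b
    | comm a i => simpa using hcomm a i
    | pow i => simpa using hpow i
    | skew i j hij => simpa using hskew i j hij⟩

section
variable {A : Type*} [Ring A] [Algebra k A] {f : G → A} {y : Fin θ → A}
    {h1 : f 1 = 1} {hmul : ∀ a b, f (a * b) = f a * f b}
    {hcomm : ∀ a i, f a * y i = (D.χ i a : k) • (y i * f a)}
    {hpow : ∀ i, y i ^ D.m i = 0}
    {hskew : ∀ i j, i ≠ j → y i * y j = (D.χ j (D.g i) : k) • (y j * y i)}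

theorem lift_of (a : G) : lift f y h1 hmul hcomm hpow hskew (of D a) = f a := by
  change RingQuot.liftAlgHom k _ (RingQuot.mkAlgHom k D.Rel _) = _
  rw [RingQuot.liftAlgHom_mkAlgHom_apply]; simp

theorem lift_x (i : Fin θ) : lift f y h1 hmul hcomm hpow hskew (x D i) = y i := by
  change RingQuot.liftAlgHom k _ (RingQuot.mkAlgHom k D.Rel _) = _
  rw [RingQuot.liftAlgHom_mkAlgHom_apply]; simp

end

theorem algHom_ext {A : Type*} [Ring A] [Algebra k A] {f f' : Bosonization D →ₐ[k] A}
    (h : ∀ a, f (of D a) = f' (of D a)) (hx : ∀ i, f (x D i) = f' (x D i)) : f = f' := by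
  refine RingQuot.ringQuot_ext' (S := k) f f' (FreeAlgebra.hom_ext (funext fun s => ?_))
  rcases s with a | i
  · exact h a
  · exact hx i

theorem induction {p : Bosonization D → Prop} (hof : ∀ a, p (of D a)) (hx : ∀ i, p (x D i))
    (hc : ∀ c, p (algebraMap k _ c)) (hadd : ∀ u v, p u → p v → p (u + v))
    (hmul : ∀ u v, p u → p v → p (u * v)) (u : Bosonization D) : p u := by
  obtain ⟨z, rfl⟩ : ∃ z, mk D z = u := RingQuot.mkAlgHom_surjective k D.Rel u
  induction z using FreeAlgebra.induction with
  | grade0 c => simpa using hc c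
  | grade1 s =>
    rcases s with a | i
    · exact hof a
    · exact hx i
  | mul u v hu hv => simpa using hmul _ _ hu hv
  | add u v hu hv => simpa using hadd _ _ hu hv

theorem m_pos (i : Fin θ) : 0 < D.m i := lt_of_lt_of_le two_pos (D.two_le_orderOf i)

theorem isPrimitiveRoot (i : Fin θ) : IsPrimitiveRoot (D.χ i (D.g i) : k) (D.m i) :=
  IsPrimitiveRoot.coe_units_iff.2 (IsPrimitiveRoot.orderOf _)

variable (D)

/-- The image of `x_i` under the comultiplication. -/
noncomputable def comulX (i : Fin θ) : Bosonization D ⊗[k] Bosonization D :=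
  of D (D.g i) ⊗ₜ x D i + x D i ⊗ₜ 1

/-- The image of `a ∈ G` under the comultiplication. -/
noncomputable def comulOf (a : G) : Bosonization D ⊗[k] Bosonization D := of D a ⊗ₜ of D a

theorem comulOf_one : comulOf D 1 = 1 := by
  rw [comulOf, of_one, Algebra.TensorProduct.one_def]

theorem comulOf_mul (a b : G) : comulOf D (a * b) = comulOf D a * comulOf D b := by
  simp [comulOf, of_mul]

theorem comulOf_mul_comulX (a : G) (i : Fin θ) :
    comulOf D a * comulX D i = (D.χ i a : k) • (comulX D i * comulOf D a) := by
  simp only [comulOf, comulX, mul_add, add_mul, Algebra.TensorProduct.tmul_mul_tmul, ← of_mul,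
    of_mul_x, mul_comm a, mul_one, one_mul, smul_add, TensorProduct.tmul_smul,
    TensorProduct.smul_tmul']

theorem comulX_pow (i : Fin θ) : comulX D i ^ D.m i = 0 := by
  rw [comulX, add_comm, add_pow_of_isPrimitiveRoot (isPrimitiveRoot i) (m_pos i)]
  · rw [Algebra.TensorProduct.tmul_pow, Algebra.TensorProduct.tmul_pow, x_pow,
      TensorProduct.zero_tmul, TensorProduct.tmul_zero, add_zero]
  · simp only [Algebra.TensorProduct.tmul_mul_tmul, of_mul_x, mul_one, one_mul,
      TensorProduct.smul_tmul']

theorem comulX_mul_comulX (i j : Fin θ) (hij : i ≠ j) :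
    comulX D i * comulX D j = (D.χ j (D.g i) : k) • (comulX D j * comulX D i) := by
  have hu : (D.χ j (D.g i) : k) * (D.χ i (D.g j) : k) = 1 := by
    rw [← Units.val_mul, D.χ_mul_χ i j hij, Units.val_one]
  simp only [comulX, mul_add, add_mul, Algebra.TensorProduct.tmul_mul_tmul, ← of_mul, of_mul_x,
    mul_comm (D.g j), mul_one, one_mul, smul_add, x_mul_x D hij, TensorProduct.tmul_smul,
    TensorProduct.smul_tmul', smul_smul, hu, one_smul]
  abel

/-- The comultiplication: `Δ a = a ⊗ a` for `a ∈ G`, `Δ x_i = g_i ⊗ x_i + x_i ⊗ 1`. -/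
noncomputable def comulHom : Bosonization D →ₐ[k] Bosonization D ⊗[k] Bosonization D :=
  lift (comulOf D) (comulX D) (comulOf_one D) (comulOf_mul D) (comulOf_mul_comulX D)
    (comulX_pow D) (comulX_mul_comulX D)

/-- The counit: `ε a = 1` for `a ∈ G`, `ε x_i = 0`. -/
noncomputable def counitHom : Bosonization D →ₐ[k] k :=
  lift (fun _ => 1) (fun _ => 0) rfl (by simp) (by simp)
    (fun i => zero_pow (m_pos i).ne') (by simp)

theorem comulHom_of (a : G) : comulHom D (of D a) = of D a ⊗ₜ of D a := by
  unfold comulHom; exact lift_of a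

theorem comulHom_x (i : Fin θ) :
    comulHom D (x D i) = of D (D.g i) ⊗ₜ x D i + x D i ⊗ₜ 1 := by
  unfold comulHom; exact lift_x i

theorem counitHom_of (a : G) : counitHom D (of D a) = 1 := by
  rw [counitHom, lift_of]

theorem counitHom_x (i : Fin θ) : counitHom D (x D i) = 0 := by
  rw [counitHom, lift_x]

noncomputable instance : Bialgebra k (Bosonization D) :=
  Bialgebra.ofAlgHom (comulHom D) (counitHom D)
    (algHom_ext (fun a => by simp [comulHom_of]) (fun i => by
      simp [comulHom_of, comulHom_x, TensorProduct.tmul_add, TensorProduct.add_tmul,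
        Algebra.TensorProduct.one_def, add_assoc]))
    (algHom_ext (fun a => by simp [comulHom_of, counitHom_of])
      (fun i => by simp [comulHom_x, counitHom_of, counitHom_x]))
    (algHom_ext (fun a => by simp [comulHom_of, counitHom_of])
      (fun i => by simp [comulHom_x, counitHom_x]))

theorem comul_of (a : G) :
    Coalgebra.comul (R := k) (of D a) = of D a ⊗ₜ[k] of D a := comulHom_of D a

theorem comul_x (i : Fin θ) :
    Coalgebra.comul (R := k) (x D i) = of D (D.g i) ⊗ₜ[k] x D i + x D i ⊗ₜ[k] 1 := comulHom_x D i

theorem counit_of (a : G) : Coalgebra.counit (R := k) (of D a) = 1 := counitHom_of D a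

theorem counit_x (i : Fin θ) : Coalgebra.counit (R := k) (x D i) = 0 := counitHom_x D i

theorem x_mul_of_inv (a : G) (i : Fin θ) :
    x D i * of D a⁻¹ = (D.χ i a : k) • (of D a⁻¹ * x D i) := by
  rw [of_mul_x, smul_smul, map_inv, Units.mul_inv, one_smul]

theorem neg_of_inv_mul_x_pow (i : Fin θ) (n : ℕ) :
    ∃ c : k, (-(of D (D.g i)⁻¹ * x D i)) ^ n = c • (of D (D.g i)⁻¹ ^ n * x D i ^ n) := by
  have hx : ∀ n : ℕ, ∃ c : k, x D i ^ n * of D (D.g i)⁻¹ = c • (of D (D.g i)⁻¹ * x D i ^ n) := by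
    intro n
    induction n with
    | zero => exact ⟨1, by simp⟩
    | succ n ih =>
      obtain ⟨c, hc⟩ := ih
      refine ⟨(D.χ i (D.g i) : k) * c, ?_⟩
      rw [pow_succ, mul_assoc, x_mul_of_inv, mul_smul_comm, ← mul_assoc, hc, smul_mul_assoc,
        smul_smul, mul_assoc]
  induction n with
  | zero => exact ⟨1, by simp⟩
  | succ n ih =>
    obtain ⟨c, hc⟩ := ih
    obtain ⟨d, hd⟩ := hx n
    refine ⟨-(c * d), ?_⟩
    rw [pow_succ, hc, mul_neg, smul_mul_assoc, mul_assoc, ← mul_assoc (x D i ^ n), hd,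
      smul_mul_assoc, mul_smul_comm, smul_smul, neg_smul, pow_succ (of D (D.g i)⁻¹),
      pow_succ (x D i)]
    simp only [mul_assoc]

/-- The antipode as an algebra map to the opposite algebra: `S a = a⁻¹` for `a ∈ G`,
`S x_i = - g_i⁻¹ x_i`. -/
noncomputable def antipodeHom : Bosonization D →ₐ[k] (Bosonization D)ᵐᵒᵖ :=
  lift (fun a => .op (of D a⁻¹)) (fun i => .op (-(of D (D.g i)⁻¹ * x D i)))
    (by rw [inv_one, of_one, MulOpposite.op_one])
    (fun a b => by rw [← MulOpposite.op_mul, ← of_mul, mul_inv, mul_comm])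
    (fun a i => by
      rw [← MulOpposite.op_mul, ← MulOpposite.op_mul, ← MulOpposite.op_smul]
      congr 1
      rw [neg_mul, mul_assoc, x_mul_of_inv, mul_smul_comm, mul_neg, ← mul_assoc, ← mul_assoc,
        ← of_mul, ← of_mul, mul_comm a⁻¹, smul_neg])
    (fun i => by
      obtain ⟨c, hc⟩ := neg_of_inv_mul_x_pow D i (D.m i)
      rw [← MulOpposite.op_pow, hc, x_pow, mul_zero, smul_zero, MulOpposite.op_zero])
    (fun i j hij => by
      have hu : (D.χ i (D.g j) : k) * (D.χ j (D.g i) : k) = 1 := by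
        rw [mul_comm, ← Units.val_mul, D.χ_mul_χ i j hij, Units.val_one]
      rw [← MulOpposite.op_mul, ← MulOpposite.op_mul, ← MulOpposite.op_smul]
      congr 1
      rw [neg_mul_neg, neg_mul_neg, mul_assoc, ← mul_assoc (x D j), x_mul_of_inv, mul_assoc,
        ← mul_assoc (x D i), x_mul_of_inv]
      simp only [smul_mul_assoc, mul_smul_comm, mul_assoc, x_mul_x D hij, smul_smul]
      rw [hu, mul_one, ← mul_assoc, ← of_mul, ← mul_assoc (of D (D.g i)⁻¹), ← of_mul,
        mul_comm (D.g i)⁻¹])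

/-- The antipode as a linear map. -/
noncomputable def antipodeMap : Bosonization D →ₗ[k] Bosonization D :=
  (MulOpposite.opLinearEquiv k).symm.toLinearMap ∘ₗ (antipodeHom D).toLinearMap

theorem antipodeMap_of (a : G) : antipodeMap D (of D a) = of D a⁻¹ := by
  change MulOpposite.unop (antipodeHom D (of D a)) = _
  rw [antipodeHom, lift_of, MulOpposite.unop_op]

theorem antipodeMap_x (i : Fin θ) : antipodeMap D (x D i) = -(of D (D.g i)⁻¹ * x D i) := by
  change MulOpposite.unop (antipodeHom D (x D i)) = _
  rw [antipodeHom, lift_x, MulOpposite.unop_op]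

theorem antipodeMap_one : antipodeMap D 1 = 1 :=
  congrArg MulOpposite.unop (map_one (antipodeHom D))

theorem antipodeMap_mul (u v : Bosonization D) :
    antipodeMap D (u * v) = antipodeMap D v * antipodeMap D u :=
  congrArg MulOpposite.unop (map_mul (antipodeHom D) u v)

theorem antipode_left (u : Bosonization D) :
    LinearMap.mul' k _ ((antipodeMap D).rTensor _ (comulHom D u)) =
      algebraMap k _ (counitHom D u) := by
  have key : ∀ (z w : Bosonization D ⊗[k] Bosonization D) (c : k),
      LinearMap.mul' k _ ((antipodeMap D).rTensor _ z) = algebraMap k _ c →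
      LinearMap.mul' k _ ((antipodeMap D).rTensor _ (z * w)) =
        c • LinearMap.mul' k _ ((antipodeMap D).rTensor _ w) := by
    intro z w c hz
    induction w with
    | zero => simp
    | add w w' h h' => simp only [mul_add, map_add, h, h', smul_add]
    | tmul p q =>
      have : LinearMap.mul' k _ ((antipodeMap D).rTensor _ (z * p ⊗ₜ q)) =
          antipodeMap D p * LinearMap.mul' k _ ((antipodeMap D).rTensor _ z) * q := by
        clear hz
        induction z with
        | zero => simp
        | add z z' h h' => simp only [add_mul, mul_add, map_add, h, h']
        | tmul s t => simp [antipodeMap_mul, mul_assoc]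
      rw [this, hz, ← Algebra.commutes, mul_assoc, ← Algebra.smul_def]
      simp
  induction u using induction with
  | hof a => simp [comulHom_of, counitHom_of, antipodeMap_of, of_inv_mul_of]
  | hx i => simp [comulHom_x, counitHom_x, antipodeMap_of, antipodeMap_x]
  | hc c =>
    rw [AlgHom.commutes, AlgHom.commutes, Algebra.algebraMap_eq_smul_one, map_smul, map_smul,
      Algebra.TensorProduct.one_def, LinearMap.rTensor_tmul, antipodeMap_one]
    simp [Algebra.algebraMap_eq_smul_one]
  | hadd u v hu hv => simp only [map_add, hu, hv]
  | hmul u v hu hv => rw [map_mul, key _ _ _ hu, hv, map_mul, map_mul, Algebra.smul_def]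

theorem antipode_right (u : Bosonization D) :
    LinearMap.mul' k _ ((antipodeMap D).lTensor _ (comulHom D u)) =
      algebraMap k _ (counitHom D u) := by
  have key : ∀ (z w : Bosonization D ⊗[k] Bosonization D) (c : k),
      LinearMap.mul' k _ ((antipodeMap D).lTensor _ w) = algebraMap k _ c →
      LinearMap.mul' k _ ((antipodeMap D).lTensor _ (z * w)) =
        c • LinearMap.mul' k _ ((antipodeMap D).lTensor _ z) := by
    intro z w c hw
    induction z with
    | zero => simp
    | add z z' h h' => simp only [add_mul, map_add, h, h', smul_add]
    | tmul p q =>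
      have : LinearMap.mul' k _ ((antipodeMap D).lTensor _ (p ⊗ₜ q * w)) =
          p * LinearMap.mul' k _ ((antipodeMap D).lTensor _ w) * antipodeMap D q := by
        clear hw
        induction w with
        | zero => simp
        | add w w' h h' => simp only [add_mul, mul_add, map_add, h, h']
        | tmul s t => simp [antipodeMap_mul, mul_assoc]
      rw [this, hw, ← Algebra.commutes, mul_assoc, ← Algebra.smul_def]
      simp
  induction u using induction with
  | hof a => simp [comulHom_of, counitHom_of, antipodeMap_of, of_mul_of_inv]
  | hx i => simp [comulHom_x, counitHom_x, antipodeMap_x, antipodeMap_one, ← mul_assoc,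
      of_mul_of_inv]
  | hc c =>
    rw [AlgHom.commutes, AlgHom.commutes, Algebra.algebraMap_eq_smul_one, map_smul, map_smul,
      Algebra.TensorProduct.one_def, LinearMap.lTensor_tmul, antipodeMap_one]
    simp [Algebra.algebraMap_eq_smul_one]
  | hadd u v hu hv => simp only [map_add, hu, hv]
  | hmul u v hu hv =>
    rw [map_mul, key _ _ _ hv, hu, map_mul, mul_comm, map_mul, Algebra.smul_def]

noncomputable instance : HopfAlgebra k (Bosonization D) where
  antipode := antipodeMap D
  mul_antipode_rTensor_comul := LinearMap.ext (antipode_left D)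
  mul_antipode_lTensor_comul := LinearMap.ext (antipode_right D)

/-! ### The elements `e_χ`, `𝐱`, `t_χ`, and the invariants -/

/-- `e_χ = |G|⁻¹ ∑_{a ∈ G} χ(a) a`. -/
noncomputable def e [Fintype G] (χ : G →* kˣ) : Bosonization D :=
  (Fintype.card G : k)⁻¹ • ∑ a : G, (χ a : k) • of D a

/-- The product `x_1 ^ (m_1 - 1) ⋯ x_θ ^ (m_θ - 1)`, in this order. -/
noncomputable def xTop : Bosonization D :=
  (List.ofFn fun i : Fin θ => x D i ^ (D.m i - 1)).prod

/-- `t_χ = e_χ x_1 ^ (m_1 - 1) ⋯ x_θ ^ (m_θ - 1)`. -/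
noncomputable def t [Fintype G] (χ : G →* kˣ) : Bosonization D := e D χ * xTop D

section
variable (R : Type*) [Ring R] [Algebra k R] [Module (Bosonization D) R]
  [IsScalarTower k (Bosonization D) R]

/-- The action of `h ∈ B` on `R`, as a linear map `r ↦ h • r`. -/
noncomputable def act (h : Bosonization D) : Module.End k R := Algebra.lsmul k k R h

/-- `R^x`, the set of `r ∈ R` with `x_i • r = 0` for all `i`. -/
noncomputable def xInvariants : Submodule k R := ⨅ i : Fin θ, LinearMap.ker (act D R (x D i))

/-- For a reordering `σ` of the indices and `n : ℕ`, the set of `r ∈ R` which are killed by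
the first `n` of `x_{σ(0)}, x_{σ(1)}, …`. -/
noncomputable def xInvariantsUpTo (σ : Equiv.Perm (Fin θ)) (n : ℕ) : Submodule k R :=
  ⨅ (i : Fin θ) (_ : (i : ℕ) < n), LinearMap.ker (act D R (x D (σ i)))

end

end

end Bosonization

/-! ### Common kernels and weight vectors -/

section Operators
variable {k M : Type*} [Field k] [AddCommGroup M] [Module k M]

/-! The elements `t D χ` satisfy `g t_χ = χ⁻¹(g) t_χ` and `x_i t_χ = 0`, so each spans a
one-dimensional left ideal of `B`. Inside the smash product this gives `(r # t_χ)(s # t_χ') = r ·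
t_{χχ'⁻¹}(s) # t_χ'` (`tmul_mul_tmul_t`, `twist_t`): primeness is governed by whether the operators
`t_χ` vanish on `R`.

1 ⇒ 2. If `t_χ(R) = 0`, then `(1 # t_χ) z (1 # t_1) = 0` for every `z`, while both outer factors are
nonzero (`t_ne_zero`).

2 ⇒ 1. Every nonzero ideal is a right `B`-submodule of `R ⊗ B`. The `x_j` act nilpotently and
commute up to scalars, so the ideal contains a nonzero weight vector killed by all of them on the
right; such a vector is some `r ⊗ t_χ` (`exists_tmul_t_mem`). The elements `s` with `s # t_χ'` in
the second ideal form a `B`-submodule of `R`, which contains a nonzero `x`-invariant `s` of some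
weight `ψ`. For such `s`, `t_η(us) = t_{ηψ}(u) s` (`t_smul_mul`), so a suitable `u` makes the
product of the two ideals nonzero, `R` being a domain.

2 ⇒ 3. The identity permutation works: apply all top powers except that of `x_n` to an element not
killed by `t_1`. The weight vectors are the values of `t_χ`.

3 ⇒ 2. The permutation shows that the product of all top powers acts nontrivially, one variable at a
time (`exists_monomial_cons_smul_ne_zero`). The crux is that `x s ≠ 0 = x² s` forces `x^n(s^n) ≠ 0`
for `n < m` (`x_pow_smul_pow`), as the quantum factorials that occur are nonzero. A weight vector of
the image, multiplied by an invariant of the complementary weight, gives a nonzero value of any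
prescribed `t_χ`. -/

theorem exists_pow_apply_ne_zero {T : Module.End k M} {z : M} (hz : z ≠ 0) {n : ℕ}
    (hT : (T ^ n) z = 0) : ∃ j, (T ^ j) z ≠ 0 ∧ T ((T ^ j) z) = 0 := by
  induction n with
  | zero => exact absurd hT hz
  | succ n ih =>
    by_cases h : (T ^ n) z = 0
    · exact ih h
    · exact ⟨n, h, by rwa [pow_succ', Module.End.mul_apply] at hT⟩

theorem Submodule.pow_apply_mem {N : Submodule k M} {T : Module.End k M}
    (hN : ∀ z ∈ N, T z ∈ N) (n : ℕ) {z : M} (hz : z ∈ N) : (T ^ n) z ∈ N := by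
  induction n with
  | zero => exact hz
  | succ n ih => rw [pow_succ', Module.End.mul_apply]; exact hN _ ih

/-- Passing from `z` to `T ^ n z` does not leave the kernels already reached; `c` need not be
invertible. -/
theorem pow_apply_eq_zero_of_commute_up_to_scalar {S T : Module.End k M} {c : k}
    (h : S * T = c • (T * S)) {z : M} (hz : S z = 0) (n : ℕ) : S ((T ^ n) z) = 0 := by
  induction n with
  | zero => exact hz
  | succ n ih =>
    rw [pow_succ', Module.End.mul_apply, ← Module.End.mul_apply, h, LinearMap.smul_apply,
      Module.End.mul_apply, ih, map_zero, smul_zero]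

/-- Nilpotent operators that commute up to scalars have a common kernel vector in every nonzero
stable subspace. -/
theorem Submodule.exists_common_kernel {ι : Type*} [Finite ι] (T : ι → Module.End k M)
    (hT : ∀ i j, i ≠ j → ∃ c : k, T i * T j = c • (T j * T i)) (hnil : ∀ i, ∃ n, T i ^ n = 0)
    {N : Submodule k M} (hN : ∀ i, ∀ z ∈ N, T i z ∈ N) (hne : N ≠ ⊥) :
    N ⊓ ⨅ i, LinearMap.ker (T i) ≠ ⊥ := by
  classical
  have := Fintype.ofFinite ι
  have key : ∀ s : Finset ι, ∃ z ∈ N, z ≠ 0 ∧ ∀ i ∈ s, T i z = 0 := by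
    intro s
    induction s using Finset.induction_on with
    | empty =>
      obtain ⟨z, hz, h0⟩ := N.exists_mem_ne_zero_of_ne_bot hne
      exact ⟨z, hz, h0, by simp⟩
    | insert j s hj ih =>
      obtain ⟨z, hz, h0, hs⟩ := ih
      obtain ⟨n, hn⟩ := hnil j
      obtain ⟨l, h1, h2⟩ := exists_pow_apply_ne_zero (T := T j) h0 (n := n) (by rw [hn]; rfl)
      refine ⟨_, N.pow_apply_mem (hN j) l hz, h1, fun i hi => ?_⟩
      obtain rfl | hi := Finset.mem_insert.1 hi
      · exact h2
      · obtain ⟨c, hc⟩ := hT i j (ne_of_mem_of_not_mem hi hj)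
        exact pow_apply_eq_zero_of_commute_up_to_scalar hc (hs i hi) l
  obtain ⟨z, hz, h0, hs⟩ := key Finset.univ
  refine fun h => h0 ((Submodule.eq_bot_iff _).1 h z ⟨hz, ?_⟩)
  simpa [Submodule.mem_iInf] using hs

variable {G : Type*} [CommGroup G] [Fintype G]

theorem finite_characters [IsAlgClosed k] [CharZero k] : Finite (G →* kˣ) := by
  have : NeZero ((Monoid.exponent G : ℕ) : k) :=
    ⟨Nat.cast_ne_zero.2 (Monoid.exponent_ne_zero_of_finite)⟩
  obtain ⟨f⟩ := CommGroup.monoidHom_mulEquiv_of_hasEnoughRootsOfUnity G k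
  exact Finite.of_equiv G f.symm.toEquiv

theorem sum_characters [IsAlgClosed k] [CharZero k] [Fintype (G →* kˣ)] [DecidableEq G] (a : G) :
    ∑ χ : G →* kˣ, (χ a : k) = if a = 1 then (Fintype.card G : k) else 0 := by
  have : NeZero ((Monoid.exponent G : ℕ) : k) :=
    ⟨Nat.cast_ne_zero.2 (Monoid.exponent_ne_zero_of_finite)⟩
  split_ifs with h
  · obtain ⟨f⟩ := CommGroup.monoidHom_mulEquiv_of_hasEnoughRootsOfUnity G k
    simp [h, Fintype.card_congr f.toEquiv]
  · obtain ⟨ψ, hψ⟩ := CommGroup.exists_apply_ne_one_of_hasEnoughRootsOfUnity G k h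
    have hs : (ψ a : k) * ∑ χ : G →* kˣ, (χ a : k) = ∑ χ : G →* kˣ, (χ a : k) := by
      rw [Finset.mul_sum]
      exact Fintype.sum_equiv (Equiv.mulLeft ψ) _ _ (fun χ => by simp)
    by_contra h0
    exact hψ (Units.ext (mul_right_cancel₀ h0 (by rw [hs, Units.val_one, one_mul])))

/-- A nonzero subspace stable under a finite abelian group contains a weight vector. -/
theorem Submodule.exists_weight_vector [IsAlgClosed k] [CharZero k] (ρ : G →* Module.End k M)
    {N : Submodule k M} (hN : ∀ a, ∀ z ∈ N, ρ a z ∈ N) (hne : N ≠ ⊥) :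
    ∃ z ∈ N, z ≠ 0 ∧ ∃ χ : G →* kˣ, ∀ a, ρ a z = (χ a : k) • z := by
  classical
  have := finite_characters (k := k) (G := G)
  have := Fintype.ofFinite (G →* kˣ)
  obtain ⟨z, hz, h0⟩ := N.exists_mem_ne_zero_of_ne_bot hne
  -- By orthogonality the unnormalised weight projections of `z` add up to `|G| z`, so one of them
  -- is nonzero.
  have hsum : ∑ χ : G →* kˣ, ∑ a : G, (χ a : k) • ρ a z = (Fintype.card G : k) • z := by
    rw [Finset.sum_comm]
    simp_rw [← Finset.sum_smul, sum_characters, ite_smul, zero_smul]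
    simp
  have hcard : (Fintype.card G : k) ≠ 0 := Nat.cast_ne_zero.2 Fintype.card_ne_zero
  obtain ⟨χ, hχ⟩ : ∃ χ : G →* kˣ, ∑ a : G, (χ a : k) • ρ a z ≠ 0 := by
    by_contra! h
    rw [Finset.sum_eq_zero fun χ _ => h χ] at hsum
    exact smul_ne_zero hcard h0 hsum.symm
  refine ⟨_, N.sum_mem fun a _ => N.smul_mem _ (hN a z hz), hχ, χ⁻¹, fun b => ?_⟩
  rw [map_sum, Finset.smul_sum]
  refine Fintype.sum_equiv (Equiv.mulLeft b) _ _ fun a => ?_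
  rw [map_smul, Equiv.coe_mulLeft, map_mul, map_mul, smul_smul, Module.End.mul_apply,
    MonoidHom.inv_apply, Units.val_mul, Units.inv_mul_cancel_left]

end Operators

namespace Bosonization

/-! ### Ordered monomials in the `x_i` and their commutation scalars. -/

section Monomials
variable {k G : Type*} [Field k] [CommGroup G] {θ : ℕ} (D : QLSDatum k G θ)

theorem of_mul_x_pow (b : G) (i : Fin θ) (n : ℕ) :
    of D b * x D i ^ n = ((D.χ i ^ n) b : k) • (x D i ^ n * of D b) := by
  induction n with
  | zero => simp
  | succ n ih =>
    rw [pow_succ, ← mul_assoc, ih, smul_mul_assoc, mul_assoc, of_mul_x, mul_smul_comm, smul_smul,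
      ← mul_assoc, pow_succ (D.χ i), MonoidHom.mul_apply, Units.val_mul]

theorem x_mul_x_pow {i j : Fin θ} (hij : i ≠ j) (n : ℕ) :
    x D i * x D j ^ n = ((D.χ j (D.g i) ^ n : kˣ) : k) • (x D j ^ n * x D i) := by
  induction n with
  | zero => simp
  | succ n ih =>
    rw [pow_succ, ← mul_assoc, ih, smul_mul_assoc, mul_assoc, x_mul_x D hij, mul_smul_comm,
      smul_smul, ← mul_assoc, pow_succ, Units.val_mul]

theorem exists_x_pow_mul_x_pow (i j : Fin θ) (n p : ℕ) :
    ∃ u : kˣ, x D i ^ n * x D j ^ p = (u : k) • (x D j ^ p * x D i ^ n) := by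
  by_cases hij : i = j
  · subst hij
    exact ⟨1, by rw [← pow_add, ← pow_add, add_comm, Units.val_one, one_smul]⟩
  · induction n with
    | zero => exact ⟨1, by simp⟩
    | succ n ih =>
      obtain ⟨u, hu⟩ := ih
      refine ⟨D.χ j (D.g i) ^ p * u, ?_⟩
      rw [pow_succ', mul_assoc, hu, mul_smul_comm, ← mul_assoc, x_mul_x_pow D hij, smul_mul_assoc,
        smul_smul, mul_assoc, Units.val_mul, mul_comm (u : k)]

/-- The product of the `x_i ^ a_i`, for `i` running through a list. -/
noncomputable def monomial (l : List (Fin θ)) (a : Fin θ → ℕ) : Bosonization D :=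
  (l.map fun i => x D i ^ a i).prod

theorem monomial_nil (a : Fin θ → ℕ) : monomial D [] a = 1 := rfl

theorem monomial_cons (i : Fin θ) (l : List (Fin θ)) (a : Fin θ → ℕ) :
    monomial D (i :: l) a = x D i ^ a i * monomial D l a := by
  simp [monomial]

theorem xTop_eq : xTop D = monomial D (List.finRange θ) fun i => D.m i - 1 := by
  rw [xTop, monomial, List.ofFn_eq_map]

/-- Adjacent factors commute up to a unit. This brings a chosen variable to the front, and compares
`xTop` with the product in the order given by `σ`. -/
theorem monomial_perm {l l' : List (Fin θ)} (h : l.Perm l') (a : Fin θ → ℕ) :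
    ∃ u : kˣ, monomial D l a = (u : k) • monomial D l' a := by
  induction h with
  | nil => exact ⟨1, by simp⟩
  | cons i _ ih =>
    obtain ⟨u, hu⟩ := ih
    exact ⟨u, by rw [monomial_cons, monomial_cons, hu, mul_smul_comm]⟩
  | swap i j l =>
    obtain ⟨u, hu⟩ := exists_x_pow_mul_x_pow D j i (a j) (a i)
    exact ⟨u, by simp only [monomial_cons, ← mul_assoc, hu, smul_mul_assoc]⟩
  | trans _ _ ih ih' =>
    obtain ⟨u, hu⟩ := ih
    obtain ⟨u', hu'⟩ := ih'
    exact ⟨u * u', by rw [hu, hu', smul_smul, Units.val_mul]⟩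

theorem exists_x_pow_mul_monomial (i : Fin θ) (n : ℕ) (l : List (Fin θ)) (a : Fin θ → ℕ) :
    ∃ u : kˣ, x D i ^ n * monomial D l a = (u : k) • (monomial D l a * x D i ^ n) := by
  induction l with
  | nil => exact ⟨1, by simp [monomial_nil]⟩
  | cons j l ih =>
    obtain ⟨u, hu⟩ := ih
    obtain ⟨u', hu'⟩ := exists_x_pow_mul_x_pow D i j n (a j)
    refine ⟨u' * u, ?_⟩
    rw [monomial_cons, ← mul_assoc, hu', smul_mul_assoc, mul_assoc, hu, mul_smul_comm, smul_smul,
      ← mul_assoc, Units.val_mul]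

theorem x_mul_monomial_eq_zero {i : Fin θ} {l : List (Fin θ)} (hi : i ∈ l) :
    x D i * monomial D l (fun i => D.m i - 1) = 0 := by
  obtain ⟨u, hu⟩ := monomial_perm D (List.perm_cons_erase hi) fun i => D.m i - 1
  rw [hu, mul_smul_comm, monomial_cons, ← mul_assoc, ← pow_succ',
    Nat.sub_add_cancel (m_pos i), x_pow, zero_mul, smul_zero]

theorem x_mul_xTop (i : Fin θ) : x D i * xTop D = 0 := by
  rw [xTop_eq, x_mul_monomial_eq_zero D (List.mem_finRange i)]

theorem monomial_eq_zero {i : Fin θ} {l : List (Fin θ)} (hi : i ∈ l) {a : Fin θ → ℕ}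
    (h : D.m i ≤ a i) : monomial D l a = 0 := by
  refine List.prod_eq_zero (List.mem_map.2 ⟨i, hi, ?_⟩)
  rw [← Nat.add_sub_cancel' h, pow_add, x_pow, zero_mul]

/-- The character by which `G` acts on a monomial by conjugation. -/
noncomputable def monomialWeight (l : List (Fin θ)) (a : Fin θ → ℕ) : G →* kˣ :=
  (l.map fun i => D.χ i ^ a i).prod

theorem monomialWeight_apply (l : List (Fin θ)) (a : Fin θ → ℕ) (b : G) :
    monomialWeight D l a b = (l.map fun i => D.χ i b ^ a i).prod := by
  induction l with
  | nil => rfl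
  | cons i l ih =>
    rw [List.map_cons, List.prod_cons, ← ih]
    rfl

theorem of_mul_monomial (b : G) (l : List (Fin θ)) (a : Fin θ → ℕ) :
    of D b * monomial D l a = (monomialWeight D l a b : k) • (monomial D l a * of D b) := by
  induction l with
  | nil => simp [monomial_nil, monomialWeight]
  | cons i l ih =>
    rw [monomial_cons, ← mul_assoc, of_mul_x_pow, smul_mul_assoc, mul_assoc, ih, mul_smul_comm,
      smul_smul, ← mul_assoc]
    simp [monomialWeight]

theorem monomial_mul_of (b : G) (l : List (Fin θ)) (a : Fin θ → ℕ) :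
    monomial D l a * of D b = ((monomialWeight D l a)⁻¹ b : k) • (of D b * monomial D l a) := by
  rw [of_mul_monomial, smul_smul, MonoidHom.inv_apply, Units.inv_mul, one_smul]

theorem monomial_congr {l : List (Fin θ)} {a a' : Fin θ → ℕ} (h : ∀ i ∈ l, a i = a' i) :
    monomial D l a = monomial D l a' := by
  rw [monomial, monomial, List.map_congr_left fun i hi => by rw [h i hi]]

theorem monomial_mul_x_of_notMem {l : List (Fin θ)} {j : Fin θ} (hj : j ∉ l) (a : Fin θ → ℕ) :
    monomial D l a * x D j =
      ((l.map fun i => D.χ j (D.g i) ^ a i).prod : kˣ) • (x D j * monomial D l a) := by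
  induction l with
  | nil => simp [monomial_nil]
  | cons i l ih =>
    rw [List.mem_cons, not_or] at hj
    have hx : x D i ^ a i * x D j = (D.χ j (D.g i) ^ a i) • (x D j * x D i ^ a i) := by
      rw [x_mul_x_pow D hj.1, Units.smul_def, smul_smul, ← Units.val_mul, ← mul_pow,
        D.χ_mul_χ _ _ (Ne.symm hj.1), one_pow, Units.val_one, one_smul]
    rw [monomial_cons, mul_assoc, ih hj.2, mul_smul_comm, ← mul_assoc, hx, smul_mul_assoc,
      smul_smul, mul_assoc, List.map_cons, List.prod_cons, mul_comm]

/-- The scalar relating `x^a x_j` to `x^{a + e_j}`. -/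
noncomputable def mulXCoeff (j : Fin θ) (a : Fin θ → ℕ) : kˣ :=
  ∏ i, if j < i then D.χ j (D.g i) ^ a i else 1

/-- Since the list increases, `x_j` coming from the right passes exactly the factors with index
above `j` before merging with the power of `x_j`. -/
theorem monomial_mul_x_of_mem {l : List (Fin θ)} (hl : l.Pairwise (· < ·)) {j : Fin θ}
    (hj : j ∈ l) (a : Fin θ → ℕ) :
    monomial D l a * x D j =
      ((l.map fun i => if j < i then D.χ j (D.g i) ^ a i else 1).prod : kˣ) •
        monomial D l (a + Pi.single j 1) := by
  induction l with
  | nil => simp at hj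
  | cons i l ih =>
    rw [List.pairwise_cons] at hl
    rw [List.map_cons, List.prod_cons, monomial_cons, monomial_cons, mul_assoc]
    by_cases hij : j = i
    · subst hij
      have hjl : j ∉ l := fun h => lt_irrefl _ (hl.1 j h)
      rw [monomial_mul_x_of_notMem D hjl, mul_smul_comm, ← mul_assoc, ← pow_succ,
        if_neg (lt_irrefl j), one_mul,
        monomial_congr D (l := l) (a := a + Pi.single j 1) (a' := a) fun i hi => by
          simp [show i ≠ j by rintro rfl; exact hjl hi],
        List.map_congr_left (l := l) (fun i hi => if_pos (hl.1 i hi))]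
      simp
    · have hj' : j ∈ l := by simpa [hij] using hj
      rw [ih hl.2 hj', mul_smul_comm, if_neg (not_lt.2 (hl.1 j hj').le), one_mul]
      simp [Ne.symm hij]

theorem monomial_mul_x (j : Fin θ) (a : Fin θ → ℕ) :
    monomial D (List.finRange θ) a * x D j =
      mulXCoeff D j a • monomial D (List.finRange θ) (a + Pi.single j 1) := by
  rw [monomial_mul_x_of_mem D (List.pairwise_lt_finRange θ) (List.mem_finRange j), mulXCoeff,
    ← List.prod_ofFn, List.ofFn_eq_map]

/-- For `i ≠ j` only one of the two orders of multiplying by `x_i` and `x_j` picks up the extra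
factor; this is what makes `regular` respect the skew relation. -/
theorem mulXCoeff_add_single (i j : Fin θ) (a : Fin θ → ℕ) :
    mulXCoeff D j (a + Pi.single i 1) =
      mulXCoeff D j a * if j < i then D.χ j (D.g i) else 1 := by
  rw [mulXCoeff, mulXCoeff, ← Finset.mul_prod_erase _ _ (Finset.mem_univ i),
    ← Finset.mul_prod_erase _ (fun l => if j < l then D.χ j (D.g l) ^ a l else 1)
      (Finset.mem_univ i),
    Finset.prod_congr rfl (g := fun l => if j < l then D.χ j (D.g l) ^ a l else 1) fun l hl => by
      simp [Finset.ne_of_mem_erase hl]]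
  split_ifs
  · simp [pow_succ]; ac_rfl
  · simp

end Monomials

/-! ### The right regular representation and the right socle -/

section Regular
variable {k G : Type*} [Field k] [CommGroup G] {θ : ℕ} (D : QLSDatum k G θ)

/-- Right multiplication by `x_j` in terms of the monomials `h x^a`. -/
noncomputable def regularX (j : Fin θ) : Module.End k (G × (Fin θ → ℕ) →₀ k) :=
  -- Exponents are not bounded by `m`. Formal monomials with some exponent at least `m_i` are
  -- harmless, because their values in `B` vanish.
  Finsupp.linearCombination k fun p => if p.2 j + 1 < D.m j then
    Finsupp.single (p.1, p.2 + Pi.single j 1) (mulXCoeff D j p.2 : k) else 0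

/-- Right multiplication by `b ∈ G` in terms of the monomials `h x^a`. -/
noncomputable def regularOf (b : G) : Module.End k (G × (Fin θ → ℕ) →₀ k) :=
  Finsupp.linearCombination k fun p =>
    Finsupp.single (p.1 * b, p.2) ((monomialWeight D (List.finRange θ) p.2)⁻¹ b : k)

theorem regularX_single (j : Fin θ) (h : G) (a : Fin θ → ℕ) (c : k) :
    regularX D j (Finsupp.single (h, a) c) = if a j + 1 < D.m j then
      Finsupp.single (h, a + Pi.single j 1) (c * mulXCoeff D j a) else 0 := by
  simp only [regularX, Finsupp.linearCombination_single]
  split_ifs <;> simp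

theorem regularOf_single (b h : G) (a : Fin θ → ℕ) (c : k) :
    regularOf D b (Finsupp.single (h, a) c) =
      Finsupp.single (h * b, a) (c * ((monomialWeight D (List.finRange θ) a)⁻¹ b : k)) := by
  simp [regularOf, Finsupp.linearCombination_single]

theorem monomialWeight_add_single (j : Fin θ) (a : Fin θ → ℕ) :
    monomialWeight D (List.finRange θ) (a + Pi.single j 1) =
      monomialWeight D (List.finRange θ) a * D.χ j := by
  ext b
  congr 1
  simp only [MonoidHom.mul_apply, monomialWeight_apply, ← List.ofFn_eq_map, List.prod_ofFn,
    Pi.add_apply, pow_add, Finset.prod_mul_distrib]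
  congr 1
  rw [Finset.prod_eq_single j (fun i _ hi => by simp [hi]) (by simp)]
  simp

/-- The exponent is `n + 1` because the zeroth power is the identity, even on a vector whose
exponent is already at least `m_j`. -/
theorem regularX_pow_single (j : Fin θ) (n : ℕ) (h : G) (a : Fin θ → ℕ) (c : k)
    (hn : D.m j ≤ a j + (n + 1)) : (regularX D j ^ (n + 1)) (Finsupp.single (h, a) c) = 0 := by
  induction n generalizing a c with
  | zero => rw [zero_add, pow_one, regularX_single, if_neg (by omega)]
  | succ n ih =>
    rw [pow_succ, Module.End.mul_apply, regularX_single]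
    split_ifs
    · exact ih _ _ (by simp; omega)
    · exact map_zero _

/-- The right regular representation, in terms of the monomials `h x^a`. -/
noncomputable def regular : Bosonization D →ₐ[k] (Module.End k (G × (Fin θ → ℕ) →₀ k))ᵐᵒᵖ :=
  lift (D := D) (fun b => MulOpposite.op (regularOf D b)) (fun j => MulOpposite.op (regularX D j))
    (by
      rw [← MulOpposite.op_one]
      congr 1
      refine Finsupp.lhom_ext fun ⟨h, a⟩ c => ?_
      simp [regularOf_single])
    (fun b b' => by
      rw [← MulOpposite.op_mul]
      congr 1
      refine Finsupp.lhom_ext fun ⟨h, a⟩ c => ?_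
      simp only [Module.End.mul_apply, regularOf_single, map_mul, Units.val_mul, mul_assoc])
    (fun b j => by
      rw [← MulOpposite.op_mul, ← MulOpposite.op_mul, ← MulOpposite.op_smul]
      congr 1
      refine Finsupp.lhom_ext fun ⟨h, a⟩ c => ?_
      simp only [Module.End.mul_apply, regularOf_single, regularX_single, LinearMap.smul_apply]
      split_ifs
      · rw [regularOf_single, monomialWeight_add_single, Finsupp.smul_single, smul_eq_mul]
        congr 1
        simp only [MonoidHom.inv_apply, MonoidHom.mul_apply, mul_inv, Units.val_mul]
        linear_combination (-c * (mulXCoeff D j a : k) *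
          (((monomialWeight D (List.finRange θ) a) b)⁻¹ : kˣ)) * (D.χ j b).mul_inv
      · simp)
    (fun j => by
      rw [← MulOpposite.op_pow, ← MulOpposite.op_zero]
      congr 1
      refine Finsupp.lhom_ext fun ⟨h, a⟩ c => ?_
      obtain ⟨n, hn⟩ := Nat.exists_eq_succ_of_ne_zero (m_pos (D := D) j).ne'
      rw [hn]
      exact regularX_pow_single D j n h a c (by omega))
    (fun i j hij => by
      rw [← MulOpposite.op_mul, ← MulOpposite.op_mul, ← MulOpposite.op_smul]
      congr 1
      refine Finsupp.lhom_ext fun ⟨h, a⟩ c => ?_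
      have hu : (D.χ j (D.g i) : k) * (D.χ i (D.g j) : k) = 1 := by
        rw [← Units.val_mul, D.χ_mul_χ i j hij, Units.val_one]
      simp only [Module.End.mul_apply, regularX_single, LinearMap.smul_apply]
      -- Unless both exponents can still grow, both sides are zero.
      by_cases hi : a i + 1 < D.m i <;> by_cases hj : a j + 1 < D.m j <;>
        simp only [hi, hj, if_true, if_false, map_zero, smul_zero, regularX_single, Pi.add_apply,
          Pi.single_eq_of_ne hij, Pi.single_eq_of_ne hij.symm, add_zero]
      rw [Finsupp.smul_single, smul_eq_mul, add_right_comm, mulXCoeff_add_single,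
        mulXCoeff_add_single]
      congr 1
      rcases lt_or_gt_of_ne hij with h | h
      · rw [if_neg h.not_gt, if_pos h, mul_one, Units.val_mul]
        linear_combination (-c * (mulXCoeff D j a : k) * (mulXCoeff D i a : k)) * hu
      · rw [if_pos h, if_neg h.not_gt, mul_one, Units.val_mul]
        ring)

theorem unop_regular_of (b : G) : (regular D (of D b)).unop = regularOf D b := by
  unfold regular
  rw [lift_of, MulOpposite.unop_op]

theorem unop_regular_x (j : Fin θ) : (regular D (x D j)).unop = regularX D j := by
  unfold regular
  rw [lift_x, MulOpposite.unop_op]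

/-- The linear map sending a formal monomial to its value. -/
noncomputable def ofMonomials : (G × (Fin θ → ℕ) →₀ k) →ₗ[k] Bosonization D :=
  Finsupp.linearCombination k fun p => of D p.1 * monomial D (List.finRange θ) p.2

/-- Applied to the formal monomial `1`, this writes each `u` as the value of a formal combination
that depends linearly on `u`. That suffices to compare coefficients without a basis theorem for `B`.
-/
theorem ofMonomials_regular (u : Bosonization D) (v : G × (Fin θ → ℕ) →₀ k) :
    ofMonomials D ((regular D u).unop v) = ofMonomials D v * u := by
  induction u using induction generalizing v with
  | hof b =>
    rw [unop_regular_of]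
    induction v using Finsupp.induction_linear with
    | zero => simp
    | add v w hv hw => simp only [map_add, add_mul, hv, hw]
    | single p c =>
      obtain ⟨h, a⟩ := p
      rw [regularOf_single]
      simp only [ofMonomials, Finsupp.linearCombination_single, smul_mul_assoc, mul_assoc]
      rw [monomial_mul_of, mul_smul_comm, smul_smul, of_mul, mul_assoc]
  | hx j =>
    rw [unop_regular_x]
    induction v using Finsupp.induction_linear with
    | zero => simp
    | add v w hv hw => simp only [map_add, add_mul, hv, hw]
    | single p c =>
      obtain ⟨h, a⟩ := p
      rw [regularX_single]
      simp only [ofMonomials, Finsupp.linearCombination_single, smul_mul_assoc, mul_assoc]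
      rw [monomial_mul_x, Units.smul_def, mul_smul_comm, smul_smul]
      split_ifs with ha
      · rw [Finsupp.linearCombination_single]
      · rw [map_zero, monomial_eq_zero D (List.mem_finRange j) (by simp; omega), mul_zero,
          smul_zero]
  | hc c =>
    rw [AlgHom.commutes, ← Algebra.commutes, ← Algebra.smul_def, ← map_smul]
    rfl
  | hadd u w hu hw => simp only [map_add, MulOpposite.unop_add, LinearMap.add_apply, hu, hw, mul_add]
  | hmul u w hu hw =>
    rw [map_mul, MulOpposite.unop_mul, Module.End.mul_apply, hw, hu, mul_assoc]

/-- The shift of exponents is injective, so the coefficient at the shifted index comes from a single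
term. -/
theorem regularX_apply (j : Fin θ) (v : G × (Fin θ → ℕ) →₀ k) (h : G) (a : Fin θ → ℕ) :
    regularX D j v (h, a + Pi.single j 1) =
      if a j + 1 < D.m j then v (h, a) * mulXCoeff D j a else 0 := by
  classical
  induction v using Finsupp.induction_linear with
  | zero => simp
  | add v w hv hw =>
    rw [map_add, Finsupp.add_apply, hv, hw]
    split_ifs <;> simp [add_mul]
  | single p c =>
    obtain ⟨h', a'⟩ := p
    rw [regularX_single]
    by_cases ha : h' = h ∧ a' = a
    · obtain ⟨rfl, rfl⟩ := ha
      split_ifs <;> simp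
    · have h1 : (h', a') ≠ (h, a) := by simpa using ha
      have h2 : (h', a' + Pi.single j 1) ≠ (h, a + Pi.single j 1) := by simpa using ha
      split_ifs <;> simp [Finsupp.single_eq_of_ne' h1, Finsupp.single_eq_of_ne' h2]

/-- The elements killed by right multiplication by all the `x_j` are in `kG xTop`. -/
theorem mem_span_of_mul_x_eq_zero {u : Bosonization D} (hu : ∀ j, u * x D j = 0) :
    u ∈ Submodule.span k (Set.range fun h : G => of D h * xTop D) := by
  set v : G × (Fin θ → ℕ) →₀ k := (regular D u).unop (Finsupp.single (1, 0) 1) with hv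
  have huv : u = ofMonomials D v := by
    rw [hv, ofMonomials_regular]
    simp [ofMonomials, of_one, monomial]
  have hker : ∀ j, regularX D j v = 0 := by
    intro j
    have h := congrArg (fun w => (regular D w).unop (Finsupp.single (1, 0) 1)) (hu j)
    simp only [map_mul, MulOpposite.unop_mul, Module.End.mul_apply, unop_regular_x, map_zero,
      MulOpposite.unop_zero, LinearMap.zero_apply] at h
    exact h
  rw [huv, ofMonomials, Finsupp.linearCombination_apply]
  refine Submodule.sum_mem _ fun p hp => Submodule.smul_mem _ _ ?_
  obtain ⟨h, a⟩ := p
  -- A smaller exponent would survive multiplication by `x_j` with a unit coefficient. Hence all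
  -- exponents are at least `m_j - 1`; beyond that value the monomial is zero.
  have ha : ∀ j, D.m j ≤ a j + 1 := by
    intro j
    by_contra! hlt
    have := regularX_apply D j v h a
    rw [hker, if_pos hlt] at this
    exact Finsupp.mem_support_iff.1 hp ((Units.mul_left_eq_zero _).1 this.symm)
  by_cases hex : ∃ j, D.m j ≤ a j
  · obtain ⟨j, hj⟩ := hex
    rw [monomial_eq_zero D (List.mem_finRange j) hj, mul_zero]
    exact Submodule.zero_mem _
  · push Not at hex
    refine Submodule.subset_span ⟨h, ?_⟩
    have : a = fun i => D.m i - 1 := funext fun j => by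
      have := ha j
      have := hex j
      omega
    rw [this, xTop_eq]

end Regular

/-! ### The right socle of `V ⊗ B`, and nonvanishing of the `t_χ`. -/

section Integrals
variable {k G : Type*} [Field k] [CommGroup G] {θ : ℕ} (D : QLSDatum k G θ)

theorem x_mul_of (b : G) (i : Fin θ) : x D i * of D b = ((D.χ i)⁻¹ b : k) • (of D b * x D i) := by
  rw [of_mul_x, smul_smul, MonoidHom.inv_apply, Units.inv_mul, one_smul]

/-- The character by which `G` acts on `xTop` by conjugation. -/
noncomputable def topWeight : G →* kˣ :=
  monomialWeight D (List.finRange θ) fun i => D.m i - 1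

theorem of_mul_xTop (b : G) : of D b * xTop D = (topWeight D b : k) • (xTop D * of D b) := by
  rw [xTop_eq, of_mul_monomial, topWeight]

theorem xTop_mul_of (b : G) : xTop D * of D b = ((topWeight D)⁻¹ b : k) • (of D b * xTop D) := by
  rw [xTop_eq, monomial_mul_of, topWeight]

/-- The automorphism of `B` that multiplies `a ∈ G` by `η(a)` and fixes the `x_i`. -/
noncomputable def twist (η : G →* kˣ) : Bosonization D →ₐ[k] Bosonization D :=
  lift (D := D) (fun a => (η a : k) • of D a) (x D) (by simp [of_one])
    (fun a b => by
      rw [smul_mul_assoc, mul_smul_comm, smul_smul, ← of_mul, map_mul, Units.val_mul])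
    (fun a i => by rw [smul_mul_assoc, of_mul_x, mul_smul_comm, smul_comm])
    (x_pow D) (fun _ _ => x_mul_x D)

theorem twist_of (η : G →* kˣ) (a : G) : twist D η (of D a) = (η a : k) • of D a := by
  unfold twist
  exact lift_of a

theorem twist_x (η : G →* kˣ) (i : Fin θ) : twist D η (x D i) = x D i := by
  unfold twist
  exact lift_x i

variable (V : Type*) [AddCommGroup V] [Module k V]

/-- Right multiplication by an element of `B` on `V ⊗ B`. -/
noncomputable def tensorMulRight (u : Bosonization D) : Module.End k (V ⊗[k] Bosonization D) :=
  (LinearMap.mulRight k u).lTensor V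

variable {V}

theorem tensorMulRight_tmul (u w : Bosonization D) (v : V) :
    tensorMulRight D V u (v ⊗ₜ w) = v ⊗ₜ (w * u) := rfl

theorem tensorMulRight_mul (u w : Bosonization D) :
    tensorMulRight D V (u * w) = tensorMulRight D V w * tensorMulRight D V u := by
  refine TensorProduct.ext' fun v p => ?_
  rw [Module.End.mul_apply, tensorMulRight_tmul, tensorMulRight_tmul, tensorMulRight_tmul,
    mul_assoc]

theorem tensorMulRight_smul (c : k) (u : Bosonization D) :
    tensorMulRight D V (c • u) = c • tensorMulRight D V u := by
  refine TensorProduct.ext' fun v p => ?_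
  rw [LinearMap.smul_apply, tensorMulRight_tmul, tensorMulRight_tmul, mul_smul_comm,
    TensorProduct.tmul_smul]

theorem tensorMulRight_one : tensorMulRight D V 1 = 1 := by
  refine TensorProduct.ext' fun v p => ?_
  rw [tensorMulRight_tmul, mul_one, Module.End.one_apply]

theorem tensorMulRight_zero : tensorMulRight D V 0 = 0 := by
  refine TensorProduct.ext' fun v p => ?_
  rw [tensorMulRight_tmul, mul_zero, TensorProduct.tmul_zero, LinearMap.zero_apply]

theorem tensorMulRight_pow (u : Bosonization D) (n : ℕ) :
    tensorMulRight D V (u ^ n) = tensorMulRight D V u ^ n := by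
  induction n with
  | zero => rw [pow_zero, pow_zero, tensorMulRight_one]
  | succ n ih => rw [pow_succ, tensorMulRight_mul, ih, pow_succ']

variable [Fintype G]

theorem of_mul_e (b : G) (χ : G →* kˣ) : of D b * e D χ = (χ⁻¹ b : k) • e D χ := by
  rw [e, mul_smul_comm, smul_comm]
  simp only [Finset.mul_sum, Finset.smul_sum]
  refine Fintype.sum_equiv (Equiv.mulLeft b) _ _ fun a => ?_
  rw [Equiv.coe_mulLeft, mul_smul_comm, ← of_mul, smul_smul (χ⁻¹ b : k),
    map_mul, MonoidHom.inv_apply, Units.val_mul, Units.inv_mul_cancel_left]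

theorem x_mul_e (i : Fin θ) (χ : G →* kˣ) : x D i * e D χ = e D (χ * (D.χ i)⁻¹) * x D i := by
  rw [e, e, mul_smul_comm, smul_mul_assoc, Finset.mul_sum, Finset.sum_mul]
  simp only [mul_smul_comm, smul_mul_assoc, x_mul_of, smul_smul, MonoidHom.mul_apply,
    Units.val_mul]

theorem of_mul_t (b : G) (χ : G →* kˣ) : of D b * t D χ = (χ⁻¹ b : k) • t D χ := by
  rw [t, ← mul_assoc, of_mul_e, smul_mul_assoc]

theorem x_mul_t (i : Fin θ) (χ : G →* kˣ) : x D i * t D χ = 0 := by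
  rw [t, ← mul_assoc, x_mul_e, mul_assoc, x_mul_xTop, mul_zero]

/-- Elements killed by right multiplication by all the `x_j` on which `G` acts by a character are
multiples of one of the `t_χ`. -/
theorem exists_eq_smul_t [CharZero k] {u : Bosonization D} (hu : ∀ j, u * x D j = 0)
    {ψ : G →* kˣ} (hψ : ∀ b, u * of D b = (ψ b : k) • u) :
    ∃ c : k, u = c • t D (ψ⁻¹ * (topWeight D)⁻¹) := by
  -- `E` is the projection onto weight `ψ` for right multiplication by `G`. It fixes `u` and sends
  -- `h xTop` to a multiple of `t`; moving group elements past `xTop` produces the factor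
  -- `(topWeight D)⁻¹`.
  let E : Bosonization D →ₗ[k] Bosonization D :=
    (Fintype.card G : k)⁻¹ • ∑ b : G, (ψ⁻¹ b : k) • LinearMap.mulRight k (of D b)
  have hE : ∀ v, E v = (Fintype.card G : k)⁻¹ • ∑ b : G, (ψ⁻¹ b : k) • (v * of D b) := by
    intro v
    simp [E, LinearMap.sum_apply]
  have hEu : E u = u := by
    have hcard : (Fintype.card G : k) ≠ 0 := Nat.cast_ne_zero.2 Fintype.card_ne_zero
    rw [hE]
    simp only [hψ, smul_smul, MonoidHom.inv_apply, Units.inv_mul, one_smul, Finset.sum_const,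
      Finset.card_univ]
    rw [← Nat.cast_smul_eq_nsmul k, smul_smul, inv_mul_cancel₀ hcard, one_smul]
  have hspan : ∀ v ∈ Submodule.span k (Set.range fun h : G => of D h * xTop D),
      ∃ c : k, E v = c • t D (ψ⁻¹ * (topWeight D)⁻¹) := by
    intro v hv
    induction hv using Submodule.span_induction with
    | mem v hv =>
      obtain ⟨h, rfl⟩ := hv
      refine ⟨_, Eq.trans ?_ (of_mul_t D h _)⟩
      rw [hE, t, e, smul_mul_assoc, mul_smul_comm, Finset.sum_mul, Finset.mul_sum]
      congr 1
      refine Finset.sum_congr rfl fun b _ => ?_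
      rw [mul_assoc, xTop_mul_of, mul_smul_comm, smul_smul, smul_mul_assoc, mul_smul_comm,
        MonoidHom.mul_apply, Units.val_mul]
    | zero => exact ⟨0, by simp⟩
    | add v w _ _ hv hw =>
      obtain ⟨c, hc⟩ := hv
      obtain ⟨d, hd⟩ := hw
      exact ⟨c + d, by rw [map_add, hc, hd, add_smul]⟩
    | smul d v _ hv =>
      obtain ⟨c, hc⟩ := hv
      exact ⟨d * c, by rw [map_smul, hc, smul_smul]⟩
  obtain ⟨c, hc⟩ := hspan u (mem_span_of_mul_x_eq_zero D hu)
  exact ⟨c, by rw [← hc, hEu]⟩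

/-- Work coordinatewise in a basis of `V`: the character depends only on `ψ`, so all coordinates are
multiples of the same `t`. -/
theorem exists_eq_tmul_t [CharZero k] {z : V ⊗[k] Bosonization D}
    (hz : ∀ j, tensorMulRight D V (x D j) z = 0) {ψ : G →* kˣ}
    (hψ : ∀ b, tensorMulRight D V (of D b) z = (ψ b : k) • z) :
    ∃ v : V, z = v ⊗ₜ t D (ψ⁻¹ * (topWeight D)⁻¹) := by
  classical
  let β := Module.Basis.ofVectorSpace k V
  let F := TensorProduct.equivFinsuppOfBasisLeft (N := Bosonization D) β
  have hF : ∀ (u : Bosonization D) (y : V ⊗[k] Bosonization D) i,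
      F (tensorMulRight D V u y) i = F y i * u := by
    intro u y i
    induction y with
    | zero => simp
    | add y y' h h' => simp only [map_add, Finsupp.add_apply, h, h', add_mul]
    | tmul v w =>
      rw [tensorMulRight_tmul, TensorProduct.equivFinsuppOfBasisLeft_apply_tmul_apply,
        TensorProduct.equivFinsuppOfBasisLeft_apply_tmul_apply, smul_mul_assoc]
  have hc : ∀ i, ∃ c : k, F z i = c • t D (ψ⁻¹ * (topWeight D)⁻¹) := fun i =>
    exists_eq_smul_t D (fun j => by rw [← hF, hz, map_zero, Finsupp.zero_apply])
      (fun b => by rw [← hF, hψ, map_smul, Finsupp.smul_apply])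
  choose c hc using hc
  refine ⟨∑ i ∈ (F z).support, c i • β i, ?_⟩
  rw [TensorProduct.sum_tmul]
  conv_lhs => rw [← F.symm_apply_apply z, TensorProduct.equivFinsuppOfBasisLeft_symm_apply,
    Finsupp.sum]
  refine Finset.sum_congr rfl fun i _ => ?_
  rw [hc, TensorProduct.smul_tmul]

/-- Every nonzero right `B`-submodule of `V ⊗ B` contains some nonzero `v ⊗ t_χ`. -/
theorem exists_tmul_t_mem [IsAlgClosed k] [CharZero k] {N : Submodule k (V ⊗[k] Bosonization D)}
    (hN : ∀ u, ∀ z ∈ N, tensorMulRight D V u z ∈ N) (hne : N ≠ ⊥) :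
    ∃ (χ : G →* kˣ) (v : V), v ⊗ₜ t D χ ∈ N ∧ v ⊗ₜ[k] t D χ ≠ 0 := by
  have hker : N ⊓ ⨅ j, LinearMap.ker (tensorMulRight D V (x D j)) ≠ ⊥ := by
    refine Submodule.exists_common_kernel _ (fun i j hij => ⟨(D.χ i (D.g j) : k), ?_⟩)
      (fun j => ⟨D.m j, ?_⟩) (fun j => hN _) hne
    · rw [← tensorMulRight_mul, ← tensorMulRight_mul, x_mul_x D hij.symm, tensorMulRight_smul]
    · rw [← tensorMulRight_pow, x_pow, tensorMulRight_zero]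
  let ρ : G →* Module.End k (V ⊗[k] Bosonization D) :=
    { toFun := fun b => tensorMulRight D V (of D b)
      map_one' := by rw [of_one, tensorMulRight_one]
      -- Right multiplication reverses products; commutativity of `G` makes this a homomorphism all
      -- the same.
      map_mul' := fun b b' => by rw [mul_comm, of_mul, tensorMulRight_mul] }
  obtain ⟨z, hz, h0, ψ, hψ⟩ := Submodule.exists_weight_vector ρ (fun b z hz => by
    simp only [Submodule.mem_inf, Submodule.mem_iInf, LinearMap.mem_ker] at hz ⊢
    refine ⟨hN _ z hz.1, fun j => ?_⟩
    change tensorMulRight D V (x D j) (tensorMulRight D V (of D b) z) = 0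
    rw [← Module.End.mul_apply, ← tensorMulRight_mul, of_mul_x, tensorMulRight_smul,
      tensorMulRight_mul, LinearMap.smul_apply, Module.End.mul_apply, hz.2, map_zero,
      smul_zero]) hker
  simp only [Submodule.mem_inf, Submodule.mem_iInf, LinearMap.mem_ker] at hz
  obtain ⟨v, rfl⟩ := exists_eq_tmul_t D hz.2 hψ
  exact ⟨_, v, hz.1, h0⟩

theorem twist_t (η χ : G →* kˣ) : twist D η (t D χ) = t D (χ * η) := by
  have hx : twist D η (xTop D) = xTop D := by
    rw [xTop, map_list_prod, List.map_ofFn]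
    congr 2
    funext i
    simp [twist_x]
  rw [t, t, map_mul, hx, e, e, map_smul, map_sum]
  simp only [map_smul, twist_of, smul_smul, MonoidHom.mul_apply, Units.val_mul]

/-- The socle statement for `k ⊗ B` yields one nonzero `t_ψ`, and `twist` maps any `t_χ` to it. -/
theorem t_ne_zero [IsAlgClosed k] [CharZero k] (χ : G →* kˣ) : t D χ ≠ 0 := by
  have : Nontrivial (Bosonization D) :=
    ⟨0, 1, fun h => zero_ne_one (α := k) (by simpa using congrArg (counitHom D) h)⟩
  have : Nontrivial (k ⊗[k] Bosonization D) := (TensorProduct.lid k _).toEquiv.nontrivial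
  obtain ⟨ψ, v, -, hv⟩ := exists_tmul_t_mem D (V := k) (N := ⊤) (fun _ _ _ => trivial) top_ne_bot
  intro h
  refine hv ?_
  rw [← mul_inv_cancel_left χ ψ, ← twist_t, h, map_zero, TensorProduct.tmul_zero]

end Integrals

/-! ### The action on a module algebra -/

section Module
variable {k G : Type*} [Field k] [CommGroup G] {θ : ℕ} (D : QLSDatum k G θ)
  {R : Type*} [AddCommGroup R] [Module (Bosonization D) R]

theorem of_smul_injective (a : G) : Function.Injective fun r : R => of D a • r := by
  intro r s h
  simpa [smul_smul, of_inv_mul_of] using congrArg (of D a⁻¹ • ·) h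

theorem of_smul_ne_zero (a : G) {r : R} (hr : r ≠ 0) : of D a • r ≠ 0 := fun h =>
  hr (of_smul_injective D a (h.trans (smul_zero _).symm))

theorem of_smul_of_inv_smul (a : G) (r : R) : of D a • of D a⁻¹ • r = r := by
  rw [smul_smul, of_mul_of_inv, one_smul]

end Module

section Action
variable {k G : Type*} [Field k] [CommGroup G] {θ : ℕ} (D : QLSDatum k G θ)
  {R : Type*} [Ring R] [Algebra k R] [Module (Bosonization D) R]
  [IsScalarTower k (Bosonization D) R]

theorem mem_xInvariants {r : R} : r ∈ xInvariants D R ↔ ∀ i, x D i • r = 0 := by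
  simp only [xInvariants, Submodule.mem_iInf, LinearMap.mem_ker]
  rfl

theorem mem_xInvariantsUpTo {σ : Equiv.Perm (Fin θ)} {n : ℕ} {r : R} :
    r ∈ xInvariantsUpTo D R σ n ↔ ∀ i : Fin θ, (i : ℕ) < n → x D (σ i) • r = 0 := by
  simp only [xInvariantsUpTo, Submodule.mem_iInf, LinearMap.mem_ker]
  rfl

theorem exists_x_pow_smul_of_smul (i : Fin θ) (n : ℕ) (b : G) (r : R) :
    ∃ u : kˣ, x D i ^ n • of D b • r = (u : k) • of D b • x D i ^ n • r := by
  refine ⟨((D.χ i ^ n) b)⁻¹, ?_⟩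
  rw [smul_smul (of D b), of_mul_x_pow, smul_assoc, smul_smul (_ : k), Units.inv_mul, one_smul,
    mul_smul]

theorem x_smul_of_smul_eq_zero {i : Fin θ} {r : R} (hr : x D i • r = 0) (b : G) :
    x D i • of D b • r = 0 := by
  rw [smul_smul, x_mul_of, smul_assoc, mul_smul, hr, smul_zero, smul_zero]

theorem exists_x_pow_smul {i : Fin θ} {z : R} (hz : z ≠ 0) :
    ∃ n, x D i ^ n • z ≠ 0 ∧ x D i • x D i ^ n • z = 0 := by
  have h : ∀ n, (act D R (x D i) ^ n) z = x D i ^ n • z := fun n => by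
    rw [act, ← map_pow]
    rfl
  obtain ⟨n, h1, h2⟩ := exists_pow_apply_ne_zero (T := act D R (x D i)) hz (n := D.m i)
    (by rw [h, x_pow, zero_smul])
  rw [h] at h1 h2
  exact ⟨n, h1, h2⟩

theorem e_smul_of_weight [Fintype G] [CharZero k] {χ : G →* kˣ} {r : R}
    (hr : ∀ b, of D b • r = (χ⁻¹ b : k) • r) : e D χ • r = r := by
  have hcard : (Fintype.card G : k) ≠ 0 := Nat.cast_ne_zero.2 Fintype.card_ne_zero
  rw [e, smul_assoc, Finset.sum_smul]
  simp only [smul_assoc, hr, smul_smul, MonoidHom.inv_apply, Units.mul_inv, one_smul,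
    Finset.sum_const, Finset.card_univ]
  rw [← Nat.cast_smul_eq_nsmul k, smul_smul, inv_mul_cancel₀ hcard, one_smul]

variable [IsModuleAlgebra k (Bosonization D) R]

theorem of_smul_mul (a : G) (r s : R) : of D a • (r * s) = (of D a • r) * (of D a • s) := by
  rw [IsModuleAlgebra.smul_mul (k := k), comul_of]
  rfl

theorem x_smul_mul (i : Fin θ) (r s : R) :
    x D i • (r * s) = (of D (D.g i) • r) * (x D i • s) + (x D i • r) * s := by
  rw [IsModuleAlgebra.smul_mul (k := k), comul_x, map_add, map_add]
  change (of D (D.g i) • r) * (x D i • s) + (x D i • r) * ((1 : Bosonization D) • s) = _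
  rw [one_smul]

theorem of_smul_one (a : G) : of D a • (1 : R) = 1 := by
  rw [IsModuleAlgebra.smul_one (k := k), counit_of, one_smul]

theorem x_smul_one (i : Fin θ) : x D i • (1 : R) = 0 := by
  rw [IsModuleAlgebra.smul_one (k := k), counit_x, zero_smul]

theorem x_smul_pow_eq_zero {i : Fin θ} {r : R} (hr : x D i • r = 0) (n : ℕ) :
    x D i • r ^ n = 0 := by
  induction n with
  | zero => rw [pow_zero, x_smul_one]
  | succ n ih => rw [pow_succ, x_smul_mul, hr, ih, mul_zero, zero_mul, add_zero]

theorem x_pow_smul_mul_of_right {i : Fin θ} {s : R} (hs : x D i • s = 0) (n : ℕ) (r : R) :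
    x D i ^ n • (r * s) = (x D i ^ n • r) * s := by
  induction n generalizing r with
  | zero => simp
  | succ n ih =>
    rw [pow_succ, mul_smul, x_smul_mul, hs, mul_zero, zero_add, ih, mul_smul]

theorem x_pow_smul_mul_of_left {i : Fin θ} {r : R} (hr : x D i • r = 0) (n : ℕ) (s : R) :
    x D i ^ n • (r * s) = (of D (D.g i ^ n) • r) * (x D i ^ n • s) := by
  induction n generalizing r s with
  | zero => simp [of_one]
  | succ n ih =>
    rw [pow_succ (x D i), mul_smul, x_smul_mul, hr, zero_mul, add_zero,
      ih (x_smul_of_smul_eq_zero D hr _), mul_smul, smul_smul, ← of_mul, ← pow_succ]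

/-- The quantum Leibniz rule for a skew derivation, cut to two terms because `x² s = 0`. The
coefficient is the quantum integer `[n]_q`; for `n = 0` the empty sum makes `n - 1` irrelevant. -/
theorem x_pow_smul_mul_of_sq {i : Fin θ} {s : R} (hs : x D i • x D i • s = 0) (n : ℕ) (r : R) :
    x D i ^ n • (r * s) = (x D i ^ n • r) * s +
      (∑ j ∈ Finset.range n, (D.χ i (D.g i) : k) ^ j) •
        ((x D i ^ (n - 1) • of D (D.g i) • r) * (x D i • s)) := by
  induction n generalizing r with
  | zero => simp
  | succ n ih =>
    rw [pow_succ, mul_smul, x_smul_mul, smul_add, x_pow_smul_mul_of_right D hs, ih, geom_sum_succ,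
      add_smul, one_smul, Nat.add_sub_cancel, mul_smul (x D i ^ n) (x D i) r]
    have h : (∑ j ∈ Finset.range n, (D.χ i (D.g i) : k) ^ j) •
        ((x D i ^ (n - 1) • of D (D.g i) • x D i • r) * (x D i • s)) =
        ((D.χ i (D.g i) : k) * ∑ j ∈ Finset.range n, (D.χ i (D.g i) : k) ^ j) •
          ((x D i ^ n • of D (D.g i) • r) * (x D i • s)) := by
      rcases n with _ | n
      · simp
      · rw [Nat.add_sub_cancel, smul_smul (of D (D.g i)), of_mul_x, smul_assoc, smul_comm,
          smul_mul_assoc, smul_smul, mul_comm, mul_smul (x D i) (of D (D.g i)),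
          smul_smul (x D i ^ n), ← pow_succ]
    rw [h]
    abel

theorem monomial_smul_mul_of_right {l : List (Fin θ)} {s : R} (hs : ∀ i ∈ l, x D i • s = 0)
    (a : Fin θ → ℕ) (r : R) : monomial D l a • (r * s) = (monomial D l a • r) * s := by
  induction l with
  | nil => simp [monomial_nil]
  | cons i l ih =>
    rw [List.forall_mem_cons] at hs
    rw [monomial_cons, mul_smul, ih hs.2, x_pow_smul_mul_of_right D hs.1, mul_smul]

/-- The group element depends only on `l` and `a`, so the left factor can be corrected by `b⁻¹`
beforehand. -/
theorem monomial_smul_mul_of_left (l : List (Fin θ)) (a : Fin θ → ℕ) :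
    ∃ b : G, ∀ r : R, (∀ i ∈ l, x D i • r = 0) → ∀ s : R,
      monomial D l a • (r * s) = (of D b • r) * (monomial D l a • s) := by
  induction l with
  | nil => exact ⟨1, fun r _ s => by simp [monomial_nil, of_one]⟩
  | cons i l ih =>
    obtain ⟨b, hb⟩ := ih
    refine ⟨D.g i ^ a i * b, fun r hr s => ?_⟩
    rw [List.forall_mem_cons] at hr
    rw [monomial_cons, mul_smul, hb r hr.2,
      x_pow_smul_mul_of_left D (x_smul_of_smul_eq_zero D hr.1 _), mul_smul, of_mul, mul_smul]

/-! ### Nonvanishing of top powers on a domain. -/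

section Domain
variable [IsDomain R]

/-- Since `x^(n+1)` kills `s^n`, the Leibniz rule for `s^n · s` leaves `[n+1]_q` times a product of
nonzero elements. The quantum integer is nonzero as long as `n + 1 < m_i`. -/
theorem x_pow_smul_pow {i : Fin θ} {s : R} (hs : x D i • s ≠ 0) (hs' : x D i • x D i • s = 0)
    (n : ℕ) : x D i ^ (n + 1) • s ^ n = 0 ∧ (n < D.m i → x D i ^ n • s ^ n ≠ 0) := by
  induction n with
  | zero => exact ⟨by rw [zero_add, pow_one, pow_zero, x_smul_one], fun _ => by simp⟩
  | succ n ih =>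
    obtain ⟨h0, h1⟩ := ih
    constructor
    · obtain ⟨u, hu⟩ := exists_x_pow_smul_of_smul D i (n + 1) (D.g i) (s ^ n)
      rw [pow_succ s, x_pow_smul_mul_of_sq D hs', pow_succ' (x D i) (n + 1), mul_smul, h0,
        Nat.add_sub_cancel, hu, h0]
      simp
    · intro hn
      obtain ⟨u, hu⟩ := exists_x_pow_smul_of_smul D i n (D.g i) (s ^ n)
      rw [pow_succ s, x_pow_smul_mul_of_sq D hs', h0, zero_mul, zero_add, Nat.add_sub_cancel, hu]
      refine smul_ne_zero (fun h => ?_) (mul_ne_zero (smul_ne_zero u.ne_zero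
        (of_smul_ne_zero D _ (h1 (by omega)))) hs)
      have := geom_sum_mul (D.χ i (D.g i) : k) (n + 1)
      rw [h, zero_mul] at this
      exact (isPrimitiveRoot i).pow_ne_one_of_pos_of_lt n.succ_ne_zero hn
        (sub_eq_zero.1 this.symm)

theorem exists_monomial_cons_smul_ne_zero {l : List (Fin θ)} {j : Fin θ} {s r : R}
    (hs : ∀ i ∈ l, x D i • s = 0) (hj : x D j • s ≠ 0)
    (hr : monomial D l (fun i => D.m i - 1) • r ≠ 0) :
    ∃ r' : R, monomial D (j :: l) (fun i => D.m i - 1) • r' ≠ 0 := by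
  -- Replace `s` by `s' = x_j^n s` with `x_j s' ≠ 0` and `x_j² s' = 0`; the variables in `l` still
  -- kill `s'`.
  obtain ⟨n, hn, hn'⟩ := exists_x_pow_smul D (i := j) hj
  set s' := x D j ^ n • s with hs'_def
  have hxs' : x D j • s' = x D j ^ n • x D j • s := by
    rw [hs'_def, smul_smul, smul_smul, ← pow_succ, ← pow_succ']
  have hs' : ∀ i ∈ l, x D i • s' = 0 := by
    intro i hi
    obtain ⟨u, hu⟩ := exists_x_pow_mul_x_pow D i j 1 n
    rw [pow_one] at hu
    rw [hs'_def, smul_smul, hu, smul_assoc, mul_smul, hs i hi, smul_zero, smul_zero]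
  have hp := (x_pow_smul_pow D (s := s') (by rwa [hxs']) (by rwa [hxs']) (D.m j - 1)).2
    (Nat.sub_lt (m_pos j) one_pos)
  -- Likewise adjust `r` by a power of `x_j`, so that `x_j` kills its image under the monomial of
  -- `l`.
  obtain ⟨N, hN, hN'⟩ := exists_x_pow_smul D (i := j) hr
  obtain ⟨u, hu⟩ := exists_x_pow_mul_monomial D j N l fun i => D.m i - 1
  obtain ⟨b, hb⟩ := monomial_smul_mul_of_left D (R := R) l fun i => D.m i - 1
  -- The monomial of `l` acts only on the right factor, then `x_j^(m_j - 1)` only on the left one,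
  -- where it is nonzero.
  refine ⟨(of D b⁻¹ • s' ^ (D.m j - 1)) * ((u : k) • x D j ^ N • r), ?_⟩
  rw [monomial_cons, mul_smul,
    hb _ (fun i hi => x_smul_of_smul_eq_zero D (x_smul_pow_eq_zero D (hs' i hi) _) _),
    of_smul_of_inv_smul, smul_comm _ (u : k), smul_smul (monomial D l _), ← smul_assoc, ← hu,
    mul_smul, x_pow_smul_mul_of_right D hN']
  exact mul_ne_zero hp hN

end Domain

section Fintype
variable [Fintype G]

theorem e_smul_mul {η ψ : G →* kˣ} {s : R} (hs : ∀ b, of D b • s = (ψ b : k) • s) (r : R) :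
    e D η • (r * s) = (e D (η * ψ) • r) * s := by
  rw [e, e, smul_assoc, smul_assoc, Finset.sum_smul, Finset.sum_smul, smul_mul_assoc,
    Finset.sum_mul]
  congr 1
  refine Finset.sum_congr rfl fun b _ => ?_
  rw [smul_assoc, smul_assoc, of_smul_mul, hs, mul_smul_comm, smul_smul,
    MonoidHom.mul_apply, Units.val_mul, smul_mul_assoc (_ * _ : k)]

/-- Multiplying by an invariant of weight `ψ` shifts the index of `t`; this links the different
`t_χ` in both implications that lead away from a hypothesis on `R`. -/
theorem t_smul_mul {η ψ : G →* kˣ} {s : R} (hx : ∀ i, x D i • s = 0)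
    (hs : ∀ b, of D b • s = (ψ b : k) • s) (r : R) :
    t D η • (r * s) = (t D (η * ψ) • r) * s := by
  rw [t, t, mul_smul, mul_smul, xTop_eq, monomial_smul_mul_of_right D fun i _ => hx i,
    e_smul_mul D hs]

end Fintype

end Action

end Bosonization

/-! ### Prime rings, elementwise -/

theorem IsPrimeRing.eq_zero_or_eq_zero {A : Type*} [Ring A] (hA : IsPrimeRing A) {a b : A}
    (h : ∀ c, a * c * b = 0) : a = 0 ∨ b = 0 := by
  let I : TwoSidedIdeal A := TwoSidedIdeal.mk' {u | ∀ c, u * c * b = 0} (by simp)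
    (fun hx hy c => by rw [add_mul, add_mul, hx, hy, add_zero])
    (fun hx c => by rw [neg_mul, neg_mul, hx, neg_zero])
    (fun {p q} hq c => by rw [mul_assoc, mul_assoc, ← mul_assoc q, hq, mul_zero])
    (fun {p q} hp c => by rw [mul_assoc p, hp])
  -- `I` consists of the `u` with `uAb = 0` and `J` of the `v` with `IAv = 0`. They contain `a` and
  -- `b`, and `IJ = 0`.
  let J : TwoSidedIdeal A := TwoSidedIdeal.mk' {v | ∀ u ∈ I, ∀ c, u * c * v = 0} (by simp)
    (fun hx hy u hu c => by rw [mul_add, hx u hu, hy u hu, add_zero])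
    (fun hx u hu c => by rw [mul_neg, hx u hu, neg_zero])
    (fun {p q} hq u hu c => by rw [← mul_assoc, mul_assoc u, hq u hu])
    (fun {p q} hp u hu c => by rw [← mul_assoc, hp u hu, zero_mul])
  have ha : a ∈ I := (TwoSidedIdeal.mem_mk' _ _ _ _ _ _ _).2 h
  have hb : b ∈ J := (TwoSidedIdeal.mem_mk' _ _ _ _ _ _ _).2 fun u hu =>
    (TwoSidedIdeal.mem_mk' _ _ _ _ _ _ _).1 hu
  have hIJ : ∀ u ∈ I, ∀ v ∈ J, u * v = 0 := fun u hu v hv => by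
    simpa using (TwoSidedIdeal.mem_mk' _ _ _ _ _ _ _).1 hv u hu 1
  refine (hA.2 I J hIJ).imp (fun h => ?_) fun h => ?_
  · rwa [h, TwoSidedIdeal.mem_bot] at ha
  · rwa [h, TwoSidedIdeal.mem_bot] at hb

theorem TensorProduct.tmul_ne_zero_of_field {k V W : Type*} [Field k] [AddCommGroup V] [Module k V]
    [AddCommGroup W] [Module k W] {v : V} {w : W} (hv : v ≠ 0) (hw : w ≠ 0) : v ⊗ₜ[k] w ≠ 0 := by
  obtain ⟨f, hf⟩ : ∃ f : Module.Dual k V, f v ≠ 0 := by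
    by_contra! h
    exact hv ((Module.forall_dual_apply_eq_zero_iff k v).1 h)
  intro h
  have := congrArg (fun z => TensorProduct.lid k W (f.rTensor W z)) h
  simp only [LinearMap.rTensor_tmul, TensorProduct.lid_tmul, map_zero] at this
  exact smul_ne_zero hf hw this

namespace Bosonization

/-! ### Left multiples of `t_χ`, invariant weight vectors, and the implication 2 ⇒ 3. -/

section Integrals
variable {k G : Type*} [Field k] [CommGroup G] [Fintype G] {θ : ℕ} (D : QLSDatum k G θ)

theorem exists_mul_t (h : Bosonization D) (χ : G →* kˣ) : ∃ c : k, h * t D χ = c • t D χ := by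
  induction h using induction with
  | hof b => exact ⟨_, of_mul_t D b χ⟩
  | hx i => exact ⟨0, by rw [x_mul_t, zero_smul]⟩
  | hc c => exact ⟨c, (Algebra.smul_def c _).symm⟩
  | hadd v w hv hw =>
    obtain ⟨c, hc⟩ := hv
    obtain ⟨d, hd⟩ := hw
    exact ⟨c + d, by rw [add_mul, hc, hd, add_smul]⟩
  | hmul v w hv hw =>
    obtain ⟨c, hc⟩ := hv
    obtain ⟨d, hd⟩ := hw
    exact ⟨d * c, by rw [mul_assoc, hd, mul_smul_comm, hc, smul_smul]⟩

variable {R : Type*} [Ring R] [Algebra k R] [Module (Bosonization D) R]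
  [IsScalarTower k (Bosonization D) R]

/-- A nonzero `B`-stable subspace contains a nonzero weight vector killed by all the `x_i`. -/
theorem exists_weight_xInvariant [IsAlgClosed k] [CharZero k] {N : Submodule k R}
    (hN : ∀ h : Bosonization D, ∀ s ∈ N, h • s ∈ N) (hne : N ≠ ⊥) :
    ∃ s ∈ N, s ≠ 0 ∧ (∀ i, x D i • s = 0) ∧
      ∃ ψ : G →* kˣ, ∀ b, of D b • s = (ψ b : k) • s := by
  have hact : ∀ (h : Bosonization D) (s : R), act D R h s = h • s := fun _ _ => rfl
  have hker : N ⊓ ⨅ j, LinearMap.ker (act D R (x D j)) ≠ ⊥ := by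
    refine Submodule.exists_common_kernel _ (fun i j hij => ⟨(D.χ j (D.g i) : k), ?_⟩)
      (fun j => ⟨D.m j, ?_⟩) (fun j => hN _) hne
    · rw [act, act, ← map_mul, ← map_mul, x_mul_x D hij, map_smul]
    · rw [act, ← map_pow, x_pow, map_zero]
  let ρ : G →* Module.End k R :=
    { toFun := fun b => act D R (of D b)
      map_one' := by rw [of_one, act, map_one]
      map_mul' := fun b b' => by rw [of_mul, act, map_mul]; rfl }
  obtain ⟨s, hs, h0, ψ, hψ⟩ := Submodule.exists_weight_vector ρ (fun b s hs => by
    simp only [Submodule.mem_inf, Submodule.mem_iInf, LinearMap.mem_ker] at hs ⊢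
    exact ⟨hN _ s hs.1, fun j => x_smul_of_smul_eq_zero D (hs.2 j) b⟩) hker
  simp only [Submodule.mem_inf, Submodule.mem_iInf, LinearMap.mem_ker] at hs
  exact ⟨s, hs.1, h0, hs.2, ψ, hψ⟩

theorem exists_perm_of_t_smul_ne_zero (ht : ∀ χ : G →* kˣ, ∃ r : R, t D χ • r ≠ 0) :
    (∃ σ : Equiv.Perm (Fin θ), ∀ n : Fin θ,
      ∃ r ∈ xInvariantsUpTo D R σ n, x D (σ n) • r ≠ 0) ∧
    ∀ χ : G →* kˣ, ∃ a ∈ xInvariants D R, a ≠ 0 ∧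
      ∀ b : G, of D b • a = ((χ b⁻¹ : kˣ) : k) • a := by
  constructor
  · refine ⟨1, fun n => ?_⟩
    obtain ⟨r, hr⟩ := ht 1
    obtain ⟨u, hu⟩ := monomial_perm D (List.perm_cons_erase (List.mem_finRange n))
      fun i => D.m i - 1
    refine ⟨monomial D ((List.finRange θ).erase n) (fun i => D.m i - 1) • r,
      (mem_xInvariantsUpTo D).2 fun i hi => ?_, fun h => hr ?_⟩
    · have hin : i ≠ n := by rintro rfl; exact lt_irrefl _ hi
      rw [Equiv.Perm.one_apply, smul_smul, x_mul_monomial_eq_zero D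
        ((List.mem_erase_of_ne hin).2 (List.mem_finRange i)), zero_smul]
    -- As `m_n ≥ 2`, the top power of `x_n` contains a factor `x_n` to act first.
    · have hm : D.m n - 1 = (D.m n - 2) + 1 := by
        have : 2 ≤ D.m n := D.two_le_orderOf n
        omega
      rw [Equiv.Perm.one_apply] at h
      rw [t, mul_smul, xTop_eq, hu, smul_assoc, monomial_cons, hm, pow_succ, mul_smul, mul_smul, h,
        smul_zero, smul_zero, smul_zero]
  · intro χ
    obtain ⟨r, hr⟩ := ht χ
    refine ⟨t D χ • r, (mem_xInvariants D).2 fun i => ?_, hr, fun b => ?_⟩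
    · rw [smul_smul, x_mul_t, zero_smul]
    · rw [smul_smul, of_mul_t, smul_assoc, map_inv, MonoidHom.inv_apply]

end Integrals

open SmashProduct

/-! ### Computations in the smash product -/

section Space
variable {k G : Type*} [Field k] [CommGroup G] {θ : ℕ} (D : QLSDatum k G θ)
  {R : Type*} [Ring R] [Algebra k R]

theorem add_tmul (r s : R) (h : Bosonization D) :
    (tmul (r + s) h : SmashProduct k R (Bosonization D)) = tmul r h + tmul s h :=
  TensorProduct.add_tmul r s h

theorem tmul_add (r : R) (h h' : Bosonization D) :
    (tmul r (h + h') : SmashProduct k R (Bosonization D)) = tmul r h + tmul r h' :=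
  TensorProduct.tmul_add r h h'

theorem smul_tmul (c : k) (r : R) (h : Bosonization D) :
    (tmul (c • r) h : SmashProduct k R (Bosonization D)) = tmul r (c • h) :=
  TensorProduct.smul_tmul c r h

theorem zero_tmul (h : Bosonization D) :
    (tmul (0 : R) h : SmashProduct k R (Bosonization D)) = 0 :=
  TensorProduct.zero_tmul R h

theorem tmul_zero (r : R) : (tmul r (0 : Bosonization D) : SmashProduct k R (Bosonization D)) = 0 :=
  TensorProduct.tmul_zero _ r

theorem tmul_ne_zero {r : R} (hr : r ≠ 0) {h : Bosonization D} (hh : h ≠ 0) :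
    (tmul r h : SmashProduct k R (Bosonization D)) ≠ 0 :=
  TensorProduct.tmul_ne_zero_of_field hr hh

/-- The identification of the underlying space of `R # B` with `R ⊗ B`. -/
noncomputable def smashEquiv : SmashProduct k R (Bosonization D) ≃ₗ[k] R ⊗[k] Bosonization D :=
  LinearEquiv.refl k _

theorem smashEquiv_tmul (r : R) (h : Bosonization D) : smashEquiv D (tmul r h) = r ⊗ₜ h := rfl

theorem smash_induction {p : SmashProduct k R (Bosonization D) → Prop}
    (htmul : ∀ r h, p (tmul r h)) (hadd : ∀ z w, p z → p w → p (z + w))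
    (z : SmashProduct k R (Bosonization D)) : p z := by
  have h0 := htmul 0 0
  rw [zero_tmul] at h0
  exact TensorProduct.induction_on (motive := p) z h0 htmul hadd

end Space

variable {k G : Type*} [Field k] [CommGroup G] {θ : ℕ} (D : QLSDatum k G θ)
  {R : Type*} [Ring R] [Algebra k R] [Module (Bosonization D) R]
  [IsScalarTower k (Bosonization D) R] [IsModuleAlgebra k (Bosonization D) R]

theorem tmul_one_mul_tmul (r s : R) (h : Bosonization D) :
    (tmul r 1 * tmul s h : SmashProduct k R (Bosonization D)) = tmul (r * s) h := by
  rw [tmul_mul_tmul {()} r s 1 h (fun _ => 1) (fun _ => 1) (by simp [Algebra.TensorProduct.one_def])]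
  simp

theorem tmul_of_mul_tmul (b : G) (s : R) (h : Bosonization D) :
    (tmul 1 (of D b) * tmul s h : SmashProduct k R (Bosonization D)) =
      tmul (of D b • s) (of D b * h) := by
  rw [tmul_mul_tmul {()} 1 s (of D b) h (fun _ => of D b) (fun _ => of D b) (by simp [comul_of])]
  simp

theorem tmul_x_mul_tmul (i : Fin θ) (s : R) (h : Bosonization D) :
    (tmul 1 (x D i) * tmul s h : SmashProduct k R (Bosonization D)) =
      tmul (of D (D.g i) • s) (x D i * h) + tmul (x D i • s) h := by
  rw [tmul_mul_tmul Finset.univ 1 s (x D i) h ![of D (D.g i), x D i] ![x D i, 1]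
    (by simp [comul_x])]
  simp

theorem tmul_one_mul_tmul_one (h u : Bosonization D) :
    (tmul (1 : R) h * tmul 1 u : SmashProduct k R (Bosonization D)) = tmul 1 (h * u) := by
  induction h using induction generalizing u with
  | hof b => rw [tmul_of_mul_tmul, of_smul_one]
  | hx i => rw [tmul_x_mul_tmul, of_smul_one, x_smul_one, zero_tmul, add_zero]
  | hc c =>
    rw [Algebra.algebraMap_eq_smul_one, ← smul_tmul, tmul_one_mul_tmul, smul_mul_assoc, one_mul,
      smul_tmul, smul_mul_assoc, one_mul]
  | hadd v w hv hw => rw [tmul_add, add_mul, hv, hw, add_mul, tmul_add]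
  | hmul v w hv hw => rw [← hv, mul_assoc, hw, hv, mul_assoc]

theorem tmul_mul_tmul_one (r : R) (h u : Bosonization D) :
    (tmul r h * tmul 1 u : SmashProduct k R (Bosonization D)) = tmul r (h * u) := by
  rw [← mul_one r, ← tmul_one_mul_tmul, mul_assoc, tmul_one_mul_tmul_one, tmul_one_mul_tmul]

theorem smashEquiv_mul_tmul_one (z : SmashProduct k R (Bosonization D)) (u : Bosonization D) :
    smashEquiv D (z * tmul 1 u) = tensorMulRight D R u (smashEquiv D z) := by
  induction z using smash_induction with
  | htmul r h =>
    rw [tmul_mul_tmul_one, smashEquiv_tmul, smashEquiv_tmul, tensorMulRight_tmul]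
  | hadd z w hz hw => rw [add_mul, map_add, hz, hw, map_add, map_add]

/-- Variables are prepended in the order of `σ`; each new one meets an element killed by all earlier
ones but not by itself. -/
theorem exists_xTop_smul_ne_zero [IsDomain R] {σ : Equiv.Perm (Fin θ)}
    (hσ : ∀ n : Fin θ, ∃ r ∈ xInvariantsUpTo D R σ n, x D (σ n) • r ≠ 0) :
    ∃ r : R, xTop D • r ≠ 0 := by
  have key : ∀ n ≤ θ, ∃ l : List (Fin θ), l.Nodup ∧
      (∀ i, i ∈ l ↔ ∃ j : Fin θ, (j : ℕ) < n ∧ σ j = i) ∧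
      ∃ r : R, monomial D l (fun i => D.m i - 1) • r ≠ 0 := by
    intro n
    induction n with
    | zero => exact fun _ => ⟨[], by simp, by simp, 1, by simp [monomial_nil]⟩
    | succ n ih =>
      intro hn
      obtain ⟨l, hl, hmem, r, hr⟩ := ih (by omega)
      obtain ⟨s, hs, hs'⟩ := hσ ⟨n, by omega⟩
      rw [mem_xInvariantsUpTo] at hs
      refine ⟨σ ⟨n, by omega⟩ :: l, List.nodup_cons.2 ⟨fun h => ?_, hl⟩, fun i => ?_,
        exists_monomial_cons_smul_ne_zero D (fun i hi => ?_) hs' hr⟩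
      · obtain ⟨j, hj, hj'⟩ := (hmem _).1 h
        rw [σ.injective hj'] at hj
        exact lt_irrefl _ hj
      · rw [List.mem_cons, hmem]
        constructor
        · rintro (rfl | ⟨j, hj, rfl⟩)
          · exact ⟨_, Nat.lt_succ_self n, rfl⟩
          · exact ⟨j, by omega, rfl⟩
        · rintro ⟨j, hj, rfl⟩
          rcases Nat.lt_succ_iff_lt_or_eq.1 hj with h | h
          · exact Or.inr ⟨j, h, rfl⟩
          · exact Or.inl (congrArg σ (Fin.ext h))
      · obtain ⟨j, hj, rfl⟩ := (hmem i).1 hi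
        exact hs j hj
  obtain ⟨l, hl, hmem, r, hr⟩ := key θ le_rfl
  have hperm : l.Perm (List.finRange θ) :=
    (List.perm_ext_iff_of_nodup hl (List.nodup_finRange θ)).2 fun i => by
      simpa [hmem] using ⟨σ.symm i, σ.apply_symm_apply i⟩
  obtain ⟨u, hu⟩ := monomial_perm D hperm fun i => D.m i - 1
  refine ⟨r, fun h => hr ?_⟩
  rw [hu, ← xTop_eq, smul_assoc, h, smul_zero]

section Fintype
variable [Fintype G]

/-- In `∑ h₁ s # h₂ t_χ` the factor `h₂` acts on `t_χ` through the character `g ↦ χ⁻¹(g)`, `x_i ↦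
0`, and contracting `Δ h` with it gives the twist. -/
theorem tmul_mul_tmul_t (h : Bosonization D) (s : R) (χ : G →* kˣ) :
    (tmul 1 h * tmul s (t D χ) : SmashProduct k R (Bosonization D)) =
      tmul (twist D χ⁻¹ h • s) (t D χ) := by
  induction h using induction generalizing s with
  | hof b => rw [tmul_of_mul_tmul, of_mul_t, ← smul_tmul, twist_of, smul_assoc]
  | hx i => rw [tmul_x_mul_tmul, x_mul_t, tmul_zero, zero_add, twist_x]
  | hc c =>
    rw [AlgHom.commutes, Algebra.algebraMap_eq_smul_one, ← smul_tmul, tmul_one_mul_tmul,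
      smul_mul_assoc, one_mul, smul_assoc, one_smul]
  | hadd v w hv hw => rw [tmul_add, add_mul, hv, hw, map_add, add_smul, add_tmul]
  | hmul v w hv hw =>
    rw [← tmul_one_mul_tmul_one, mul_assoc, hw, hv, map_mul, mul_smul]

theorem mem_ideal_smul {I : TwoSidedIdeal (SmashProduct k R (Bosonization D))} {χ : G →* kˣ}
    {s : R} (hs : tmul s (t D χ) ∈ I) (h : Bosonization D) :
    tmul (h • s) (t D χ) ∈ I := by
  have := I.mul_mem_left (tmul 1 (twist D χ h)) _ hs
  rw [tmul_mul_tmul_t] at this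
  have htw : twist D χ⁻¹ (twist D χ h) = h := by
    have : (twist D χ⁻¹).comp (twist D χ) = AlgHom.id k _ :=
      algHom_ext (fun a => by
        rw [AlgHom.comp_apply, twist_of, map_smul, twist_of, smul_smul, MonoidHom.inv_apply,
          Units.mul_inv, one_smul, AlgHom.id_apply]) (fun i => by
        rw [AlgHom.comp_apply, twist_x, twist_x, AlgHom.id_apply])
    exact DFunLike.congr_fun this h
  rwa [htw] at this

variable [IsAlgClosed k] [CharZero k]

/-! ### The implications -/

theorem exists_t_smul_ne_zero_of_isPrimeRing [Nontrivial R]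
    (hp : IsPrimeRing (SmashProduct k R (Bosonization D))) (χ : G →* kˣ) :
    ∃ r : R, t D χ • r ≠ 0 := by
  by_contra! h
  have hz : ∀ z : SmashProduct k R (Bosonization D),
      tmul 1 (t D χ) * z * tmul 1 (t D 1) = 0 := by
    intro z
    induction z using smash_induction with
    | htmul r u =>
      obtain ⟨c, hc⟩ := exists_mul_t D u 1
      rw [mul_assoc, tmul_mul_tmul_one, hc, ← smul_tmul, tmul_mul_tmul_t, twist_t,
        show χ * (1 : G →* kˣ)⁻¹ = χ from MonoidHom.ext fun b => by
          rw [MonoidHom.mul_apply, MonoidHom.inv_apply, MonoidHom.one_apply, inv_one, mul_one],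
        h, zero_tmul]
    | hadd z w hz hw => rw [mul_add, add_mul, hz, hw, add_zero]
  rcases hp.eq_zero_or_eq_zero hz with h | h
  · exact tmul_ne_zero D (one_ne_zero (α := R)) (t_ne_zero D _) h
  · exact tmul_ne_zero D (one_ne_zero (α := R)) (t_ne_zero D _) h

/-- Every nonzero ideal of the smash product contains some nonzero `r # t_χ`. -/
theorem exists_tmul_t_mem_ideal {I : TwoSidedIdeal (SmashProduct k R (Bosonization D))}
    (hI : I ≠ ⊥) : ∃ (χ : G →* kˣ) (r : R), r ≠ 0 ∧ tmul r (t D χ) ∈ I := by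
  let N : Submodule k (R ⊗[k] Bosonization D) :=
    { carrier := {z | (smashEquiv D).symm z ∈ I}
      add_mem' := fun {z w} hz hw => by
        rw [Set.mem_ofPred_eq, map_add]
        exact I.add_mem hz hw
      zero_mem' := by
        rw [Set.mem_ofPred_eq, map_zero]
        exact I.zero_mem
      smul_mem' := fun c z hz => by
        rw [Set.mem_ofPred_eq, map_smul, Algebra.smul_def]
        exact I.mul_mem_left _ _ hz }
  have hN : ∀ u, ∀ z ∈ N, tensorMulRight D R u z ∈ N := by
    intro u z hz
    have : (smashEquiv D).symm z * tmul 1 u ∈ I := I.mul_mem_right _ _ hz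
    rwa [← (smashEquiv D).symm_apply_apply (_ * _), smashEquiv_mul_tmul_one,
      LinearEquiv.apply_symm_apply] at this
  have hne : N ≠ ⊥ := by
    refine fun h => hI (eq_bot_iff.2 fun z hz => (TwoSidedIdeal.mem_bot _).2 ?_)
    have := (Submodule.eq_bot_iff N).1 h (smashEquiv D z) (by
      change (smashEquiv D).symm (smashEquiv D z) ∈ I
      rwa [LinearEquiv.symm_apply_apply])
    rwa [LinearEquiv.map_eq_zero_iff] at this
  obtain ⟨χ, r, h1, h2⟩ := exists_tmul_t_mem D hN hne
  exact ⟨χ, r, fun h => h2 (by rw [h, TensorProduct.zero_tmul]), h1⟩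

theorem isPrimeRing_of_t_smul_ne_zero [IsDomain R]
    (ht : ∀ χ : G →* kˣ, ∃ r : R, t D χ • r ≠ 0) :
    IsPrimeRing (SmashProduct k R (Bosonization D)) := by
  refine ⟨⟨_, 0, tmul_ne_zero D (one_ne_zero (α := R)) (t_ne_zero D 1)⟩, fun I J hIJ => ?_⟩
  by_contra! hne
  obtain ⟨χ, r, hr, hrI⟩ := exists_tmul_t_mem_ideal D hne.1
  obtain ⟨χ', s', hs', hsJ'⟩ := exists_tmul_t_mem_ideal D hne.2
  let N : Submodule k R :=
    { carrier := {s | tmul s (t D χ') ∈ J}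
      add_mem' := fun {v w} hv hw => by
        simp only [Set.mem_ofPred_eq, add_tmul] at hv hw ⊢
        exact J.add_mem hv hw
      zero_mem' := by
        simp only [Set.mem_ofPred_eq, zero_tmul]
        exact J.zero_mem
      smul_mem' := fun c v hv => by
        simp only [Set.mem_ofPred_eq] at hv ⊢
        have := mem_ideal_smul D hv (algebraMap k _ c)
        rwa [Algebra.algebraMap_eq_smul_one, smul_assoc, one_smul] at this }
  obtain ⟨s, hsJ, hs, hx, ψ, hψ⟩ := exists_weight_xInvariant D (N := N)
    (fun h v hv => mem_ideal_smul D hv h)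
    (fun h => hs' ((Submodule.eq_bot_iff N).1 h s' hsJ'))
  -- Passing `t_χ` over `t_χ'` gives `χχ'⁻¹`, and pulling out `s` multiplies by its weight `ψ`.
  obtain ⟨u, hu⟩ := ht (χ * χ'⁻¹ * ψ)
  have h1 := J.mul_mem_left (tmul u 1) _ hsJ
  rw [tmul_one_mul_tmul] at h1
  have h2 := hIJ _ hrI _ h1
  rw [← mul_one r, ← tmul_one_mul_tmul, mul_assoc, tmul_mul_tmul_t, tmul_one_mul_tmul, twist_t,
    t_smul_mul D hx hψ] at h2
  exact tmul_ne_zero D (mul_ne_zero hr (mul_ne_zero hu hs)) (t_ne_zero D _) h2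

theorem t_smul_ne_zero_of_exists_perm [IsDomain R]
    (h : (∃ σ : Equiv.Perm (Fin θ), ∀ n : Fin θ,
      ∃ r ∈ xInvariantsUpTo D R σ n, x D (σ n) • r ≠ 0) ∧
    ∀ χ : G →* kˣ, ∃ a ∈ xInvariants D R, a ≠ 0 ∧
      ∀ b : G, of D b • a = ((χ b⁻¹ : kˣ) : k) • a) (χ : G →* kˣ) :
    ∃ r : R, t D χ • r ≠ 0 := by
  obtain ⟨⟨σ, hσ⟩, hinv⟩ := h
  obtain ⟨r, hr⟩ := exists_xTop_smul_ne_zero D hσ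
  let N : Submodule k R := LinearMap.range (act D R (xTop D))
  let ρ : G →* Module.End k R :=
    { toFun := fun b => act D R (of D b)
      map_one' := by rw [of_one, act, map_one]
      map_mul' := fun b b' => by rw [of_mul, act, map_mul]; rfl }
  obtain ⟨_, ⟨r₁, rfl⟩, h0, ψ, hψ⟩ := Submodule.exists_weight_vector (N := N) ρ
    (fun b s hs => by
      obtain ⟨s, rfl⟩ := hs
      refine ⟨(topWeight D b : k) • of D b • s, ?_⟩
      change xTop D • (topWeight D b : k) • of D b • s = of D b • xTop D • s
      rw [smul_smul (of D b), of_mul_xTop, smul_comm, smul_assoc, mul_smul])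
    (fun h => hr ((Submodule.eq_bot_iff N).1 h _ ⟨r, rfl⟩))
  -- With `a` of weight `(χψ)⁻¹`, `t_χ(r₁ a) = t_{ψ⁻¹}(r₁) a`, and `e_{ψ⁻¹}` fixes the weight vector
  -- `xTop • r₁`.
  obtain ⟨a, ha, ha0, hwt⟩ := hinv (χ * ψ)
  rw [mem_xInvariants] at ha
  refine ⟨r₁ * a, ?_⟩
  rw [t_smul_mul D (ψ := (χ * ψ)⁻¹) ha fun b => by rw [hwt, map_inv, MonoidHom.inv_apply],
    show χ * (χ * ψ)⁻¹ = ψ⁻¹ from MonoidHom.ext fun b => by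
      rw [MonoidHom.mul_apply, MonoidHom.inv_apply, MonoidHom.mul_apply, mul_inv,
        mul_inv_cancel_left, MonoidHom.inv_apply], t, mul_smul,
    e_smul_of_weight D fun b => by
      rw [MonoidHom.inv_apply, MonoidHom.inv_apply, inv_inv]
      exact hψ b]
  exact mul_ne_zero h0 ha0

end Fintype

end Bosonization

theorem corollary3p8 {k : Type*} [Field k] [IsAlgClosed k] [CharZero k]
    {G : Type*} [CommGroup G] [Fintype G] {θ : ℕ} (D : QLSDatum k G θ)
    (R : Type*) [Ring R] [IsDomain R] [Algebra k R] [Module (Bosonization D) R]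
    [IsScalarTower k (Bosonization D) R] [IsModuleAlgebra k (Bosonization D) R] :
    List.TFAE [
      IsPrimeRing (SmashProduct k R (Bosonization D)),
      ∀ χ : G →* kˣ, ∃ r : R, Bosonization.t D χ • r ≠ 0,
      (∃ σ : Equiv.Perm (Fin θ), ∀ n : Fin θ,
          ∃ r ∈ Bosonization.xInvariantsUpTo D R σ n, Bosonization.x D (σ n) • r ≠ 0) ∧
        ∀ χ : G →* kˣ, ∃ a ∈ Bosonization.xInvariants D R, a ≠ 0 ∧
          ∀ g : G, Bosonization.of D g • a = ((χ g⁻¹ : kˣ) : k) • a] := by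
  tfae_have 1 → 2 := Bosonization.exists_t_smul_ne_zero_of_isPrimeRing D
  tfae_have 2 → 1 := Bosonization.isPrimeRing_of_t_smul_ne_zero D
  tfae_have 2 → 3 := Bosonization.exists_perm_of_t_smul_ne_zero D
  tfae_have 3 → 2 := Bosonization.t_smul_ne_zero_of_exists_perm D
  tfae_finish
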